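/- **Theorem.** Let $(M^{n+1},g)$ and $(N^n,h)$ be smooth Riemannian manifolds and let $\varphi:(M^{n+1},g)\to(N^n,h)$ be a Riemannian submersion (so that its fibres are $1$-dimensional). For a smooth map $\varphi$, let $\tau(\varphi)=\mathrm{Trace}_g\nabla d\varphi$ be the tension field, let $\nabla^\varphi$ be the pull-back of the Levi-Civita connection of $N$ to $\varphi^{-1}TN$, let $\Delta^\varphi=-\mathrm{Trace}_g(\nabla^\varphi\nabla^\varphi-\nabla^\varphi_{\nabla^M})$, and let $R^N(X,Y)Z=[\nabla^N_X,\nabla^N_Y]Z-\nabla^N_{[X,Y]}Z$; $\varphi$ is called biharmonic on an open set $W\subseteq M$ if it satisfies there the biharmonic map equation (the Euler–Lagrange equation of the bienergy $\frac12\int|\tau(\varphi)|^2dv_g$) $$\tau^2(\varphi):=-\Delta^\varphi\tau(\varphi)-\mathrm{Trace}_g R^N(d\varphi,\tau(\varphi))d\varphi=0 .$$ An *adapted frame* on an open set $U\subseteq M$ is a smooth orthonormal frame $\{e_1,\dots,e_{n+1}\}$ on $U$ with $e_{n+1}$ vertical and with $e_1,\dots,e_n$ $\varphi$-related to a smooth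 orthonormal frame $\{\varepsilon_1,\dots,\varepsilon_n\}$ on an open set $V\supseteq\varphi(U)$ of $N$. Its *integrability data* $\{f^k_{ij},\kappa_i,\sigma_{ij}\}$ ($1\le i,j,k\le n$) are the smooth functions on $U$ given by $f^k_{ij}=F^k_{ij}\circ\varphi$, where $[\varepsilon_i,\varepsilon_j]=\sum_k F^k_{ij}\varepsilon_k$ on $V$, and by $$[e_i,e_{n+1}]=\kappa_i e_{n+1},\qquad [e_i,e_j]=\sum_{k=1}^n f^k_{ij}e_k-2\sigma_{ij}e_{n+1}.$$ Put $P^k_{ij}=\tfrac12\left(-f^j_{ik}-f^i_{jk}+f^k_{ij}\right)$, let $\mu=(\nabla^M_{e_{n+1}}e_{n+1})^{\mathcal H}$ (horizontal part) be the mean curvature vector field of the fibres, and let $\Delta=\mathrm{div}\,\mathrm{grad}$ be the Laplacian of $(M,g)$ on functions. Consider a family of adapted frames with domains $U_\alpha$, and put $W=\bigcup_\alpha U_\alpha$ (for example a single adapted frame on $U=W$, or a family whose domains cover $M$, so that $W=M$). Then $\varphi$ is biharmonic on $W$ if and only if, for each frame of the family, its integrability data satisfy on its domain $$\Delta\kappa_k+\sum_{i,j=1}^n\Big(2e_i(\kappa_j)P^k_{ij}+\kappa_j\Big[e_i(P^k_{ij})+\sum_{l=1}^nP^l_{ij}P^k_{il}-\kappa_iP^k_{ij}-\sum_{l=1}^nP^l_{ii}P^k_{lj}\Big]\Big)+\mathrm{Ricci}^N\big(d\varphi(\mu),d\varphi(e_k)\big)=0,\qquad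 k=1,\dots,n .$$ -/

import Mathlib

open scoped Manifold ContDiff Bundle
open Bundle (RiemannianBundle)

namespace RiemSubm

noncomputable section

section Connection

variable {E : Type*} [NormedAddCommGroup E] [NormedSpace ℝ E] [FiniteDimensional ℝ E]
  {H : Type*} [TopologicalSpace H] (I : ModelWithCorners ℝ E H)
  {M : Type*} [TopologicalSpace M] [ChartedSpace H M] [IsManifold I ∞ M]
  [RiemannianBundle (fun x : M => TangentSpace I x)]

/-- The tangent spaces of a finite-dimensional manifold are finite-dimensional. -/
instance finiteDimensional_tangentSpace (x : M) : FiniteDimensional ℝ (TangentSpace I x) :=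
  inferInstanceAs (FiniteDimensional ℝ E)

/-- An orthonormal basis of the tangent space `T_x M` with respect to the Riemannian metric. Traces
of bilinear maps are computed in this basis. -/
def onb (x : M) : OrthonormalBasis (Fin (Module.finrank ℝ (TangentSpace I x))) ℝ
    (TangentSpace I x) :=
  stdOrthonormalBasis ℝ (TangentSpace I x)

/-- A vector field, smooth near `x`, whose value at `x` is the tangent vector `v` (it has constant
coefficients in the preferred chart at `x`). Tensorial expressions are evaluated on tangent vectors
by means of this extension. -/
def ext {x : M} (v : TangentSpace I x) : Π y : M, TangentSpace I y :=
  FiberBundle.extend E v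

/-- The right-hand side of the Koszul formula,
`X⟨Y,Z⟩ + Y⟨X,Z⟩ - Z⟨X,Y⟩ + ⟨[X,Y],Z⟩ - ⟨[X,Z],Y⟩ - ⟨[Y,Z],X⟩`, at the point `x`. -/
def koszul (X Y Z : Π x : M, TangentSpace I x) (x : M) : ℝ :=
  mvfderiv I (fun y => inner ℝ (Y y) (Z y)) x (X x)
    + mvfderiv I (fun y => inner ℝ (X y) (Z y)) x (Y x)
    - mvfderiv I (fun y => inner ℝ (X y) (Y y)) x (Z x)
    + inner ℝ (VectorField.mlieBracket I X Y x) (Z x)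
    - inner ℝ (VectorField.mlieBracket I X Z x) (Y x)
    - inner ℝ (VectorField.mlieBracket I Y Z x) (X x)

/-- The Levi-Civita connection: `leviCivita I Y x v` is `∇_v Y` at `x`, the vector determined by
the Koszul formula `2⟨∇_v Y, Z⟩ = koszul (v, Y, Z)`. The argument order is that of Mathlib's
covariant derivatives. -/
def leviCivita (Y : Π x : M, TangentSpace I x) (x : M) (v : TangentSpace I x) :
    TangentSpace I x :=
  ∑ a, ((1 / 2 : ℝ) * koszul I (ext I v) Y (ext I (onb I x a)) x) • onb I x a

/-- The Laplacian on functions with the sign `Δ = div grad`: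
`Δ f = ∑ₐ (eₐ (eₐ f) - (∇_{eₐ} eₐ) f)`, the trace of the Hessian. -/
def laplacian (f : M → ℝ) (x : M) : ℝ :=
  ∑ a, (mvfderiv I (fun y => mvfderiv I f y (ext I (onb I x a) y)) x (onb I x a)
    - mvfderiv I f x (leviCivita I (ext I (onb I x a)) x (onb I x a)))

/-- The curvature operator `R(X,Y)Z = ∇_X ∇_Y Z - ∇_Y ∇_X Z - ∇_{[X,Y]} Z`, evaluated on tangent
vectors `u, v, w` at `x`. -/
def curvature (x : M) (u v w : TangentSpace I x) : TangentSpace I x :=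
  leviCivita I (fun y => leviCivita I (ext I w) y (ext I v y)) x u
    - leviCivita I (fun y => leviCivita I (ext I w) y (ext I u y)) x v
    - leviCivita I (ext I w) x (VectorField.mlieBracket I (ext I u) (ext I v) x)

/-- The Ricci tensor `Ricci(v, w) = trace (u ↦ R(u, v) w)`. -/
def ricci (x : M) (v w : TangentSpace I x) : ℝ :=
  ∑ a, inner ℝ (curvature I x (onb I x a) v w) (onb I x a)

end Connection

section Maps

variable {E : Type*} [NormedAddCommGroup E] [NormedSpace ℝ E] [FiniteDimensional ℝ E]
  {H : Type*} [TopologicalSpace H] (I : ModelWithCorners ℝ E H)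
  {M : Type*} [TopologicalSpace M] [ChartedSpace H M] [IsManifold I ∞ M]
  [RiemannianBundle (fun x : M => TangentSpace I x)]
  {E' : Type*} [NormedAddCommGroup E'] [NormedSpace ℝ E'] [FiniteDimensional ℝ E']
  {H' : Type*} [TopologicalSpace H'] (J : ModelWithCorners ℝ E' H')
  {N : Type*} [TopologicalSpace N] [ChartedSpace H' N] [IsManifold J ∞ N]
  [RiemannianBundle (fun y : N => TangentSpace J y)]

/-- The pull-back connection `∇^φ` on sections `W` of `φ⁻¹ TN`; `pullbackConn I J φ W x v` is
`∇^φ_v W`. Let `∂_γ` be the local frame of `TN` near `φ x` given by the trivialization at `φ x`,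
and write `W = ∑ W^γ (∂_γ ∘ φ)`. Then
`∇^φ_v W = ∑ (d W^γ (v) ∂_γ + W^γ(x) ∇^N_{dφ(v)} ∂_γ)`: the first part below is the derivative of
the coefficients of `W`, and in the second one `ext J (W x) = ∑ W^γ(x) ∂_γ`. -/
def pullbackConn (φ : M → N) (W : Π x : M, TangentSpace J (φ x)) (x : M) (v : TangentSpace I x) :
    TangentSpace J (φ x) :=
  (trivializationAt E' (TangentSpace J : N → Type _) (φ x)).symm (φ x)
      (mvfderiv I (fun y =>
        ((trivializationAt E' (TangentSpace J : N → Type _) (φ x))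
          (⟨φ y, W y⟩ : TangentBundle J N)).2) x v)
    + leviCivita J (ext J (W x)) (φ x) (mfderiv I J φ x v)

/-- The tension field `τ(φ) = Trace_g ∇dφ = ∑ₐ (∇^φ_{eₐ} dφ(eₐ) - dφ(∇^M_{eₐ} eₐ))`. -/
def tension (φ : M → N) (x : M) : TangentSpace J (φ x) :=
  ∑ a, (pullbackConn I J φ (fun y => mfderiv I J φ y (ext I (onb I x a) y)) x (onb I x a)
    - mfderiv I J φ x (leviCivita I (ext I (onb I x a)) x (onb I x a)))

/-- The Laplacian on sections of `φ⁻¹ TN`,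
`Δ^φ W = - ∑ₐ (∇^φ_{eₐ} ∇^φ_{eₐ} W - ∇^φ_{∇^M_{eₐ} eₐ} W)`. -/
def roughLaplacian (φ : M → N) (W : Π x : M, TangentSpace J (φ x)) (x : M) :
    TangentSpace J (φ x) :=
  -∑ a, (pullbackConn I J φ (fun y => pullbackConn I J φ W y (ext I (onb I x a) y)) x (onb I x a)
    - pullbackConn I J φ W x (leviCivita I (ext I (onb I x a)) x (onb I x a)))

/-- The bitension field `τ²(φ) = -Δ^φ τ(φ) - Trace_g R^N(dφ, τ(φ)) dφ`. -/
def bitension (φ : M → N) (x : M) : TangentSpace J (φ x) :=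
  -roughLaplacian I J φ (tension I J φ) x
    - ∑ a, curvature J (φ x) (mfderiv I J φ x (onb I x a)) (tension I J φ x)
        (mfderiv I J φ x (onb I x a))

/-- `φ` is biharmonic on the set `W`: the biharmonic map equation `τ²(φ) = 0` holds on `W`. -/
def IsBiharmonicOn (φ : M → N) (W : Set M) : Prop :=
  ∀ x ∈ W, bitension I J φ x = 0

/-- The horizontal space at `x`: the orthogonal complement of the vertical space `ker dφ_x`. -/
def horizontal (φ : M → N) (x : M) : Submodule ℝ (TangentSpace I x) :=
  (LinearMap.ker (mfderiv I J φ x).toLinearMap)ᗮ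

/-- A Riemannian submersion: a smooth map whose differentials are onto and preserve the inner
product of horizontal vectors. -/
structure IsRiemannianSubmersion (φ : M → N) : Prop where
  contMDiff : ContMDiff I J ∞ φ
  surjective : ∀ x, Function.Surjective (mfderiv I J φ x)
  inner_eq : ∀ x, ∀ v ∈ horizontal I J φ x, ∀ w ∈ horizontal I J φ x,
    inner ℝ (mfderiv I J φ x v) (mfderiv I J φ x w) = inner ℝ v w

/-- The mean curvature vector field `μ = (∇_V V)^𝓗` of one-dimensional fibres, where `V` is a
vertical vector field of unit length. -/
def fibreMeanCurvature (φ : M → N) (V : Π x : M, TangentSpace I x) (x : M) : TangentSpace I x :=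
  (horizontal I J φ x).starProjection (leviCivita I V x (V x))

end Maps

section Frames

variable {n : ℕ}
  {M : Type*} [TopologicalSpace M] [ChartedSpace (EuclideanSpace ℝ (Fin (n + 1))) M]
  [IsManifold (𝓡 (n + 1)) ∞ M] [RiemannianBundle (fun x : M => TangentSpace (𝓡 (n + 1)) x)]
  {N : Type*} [TopologicalSpace N] [ChartedSpace (EuclideanSpace ℝ (Fin n)) N]
  [IsManifold (𝓡 n) ∞ N] [RiemannianBundle (fun y : N => TangentSpace (𝓡 n) y)]

/-- A local orthonormal frame `e_1, …, e_{n+1}` on an open set `domain` of `M` adapted to `φ`: the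
field `e_{n+1}` is vertical and `e_1, …, e_n` are `φ`-related to a local orthonormal frame
`ε_1, …, ε_n` on an open set `base` of `N`. (The fields `e_1, …, e_n` are horizontal, since they
are orthogonal to `e_{n+1}`.) -/
structure AdaptedFrame (n : ℕ)
    {M : Type*} [TopologicalSpace M] [ChartedSpace (EuclideanSpace ℝ (Fin (n + 1))) M]
    [IsManifold (𝓡 (n + 1)) ∞ M] [RiemannianBundle (fun x : M => TangentSpace (𝓡 (n + 1)) x)]
    {N : Type*} [TopologicalSpace N] [ChartedSpace (EuclideanSpace ℝ (Fin n)) N]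
    [IsManifold (𝓡 n) ∞ N] [RiemannianBundle (fun y : N => TangentSpace (𝓡 n) y)]
    (φ : M → N) where
  /-- the open set on which the frame of `M` lives -/
  domain : Set M
  isOpen_domain : IsOpen domain
  /-- the open set on which the frame of `N` lives -/
  base : Set N
  isOpen_base : IsOpen base
  mapsTo : Set.MapsTo φ domain base
  /-- the fields `e_1, …, e_{n+1}` -/
  e : Fin (n + 1) → Π x : M, TangentSpace (𝓡 (n + 1)) x
  /-- the fields `ε_1, …, ε_n` -/
  ε : Fin n → Π y : N, TangentSpace (𝓡 n) y
  contMDiffOn_e : ∀ a, ContMDiffOn (𝓡 (n + 1)) (𝓡 (n + 1)).tangent ∞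
    (fun x => (⟨x, e a x⟩ : TangentBundle (𝓡 (n + 1)) M)) domain
  contMDiffOn_ε : ∀ i, ContMDiffOn (𝓡 n) (𝓡 n).tangent ∞
    (fun y => (⟨y, ε i y⟩ : TangentBundle (𝓡 n) N)) base
  orthonormal_e : ∀ x ∈ domain, Orthonormal ℝ (fun a => e a x)
  orthonormal_ε : ∀ y ∈ base, Orthonormal ℝ (fun i => ε i y)
  related : ∀ x ∈ domain, ∀ i : Fin n,
    mfderiv (𝓡 (n + 1)) (𝓡 n) φ x (e i.castSucc x) = ε i (φ x)
  vertical : ∀ x ∈ domain, mfderiv (𝓡 (n + 1)) (𝓡 n) φ x (e (Fin.last n) x) = 0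

/-- The integrability data `{f^k_{ij} = F^k_{ij} ∘ φ, κ_i, σ_{ij}}` of an adapted frame; `F i j k`
is `F^k_{ij}`. They are defined by
`[ε_i, ε_j] = ∑_k F^k_{ij} ε_k`, `[e_i, e_{n+1}] = κ_i e_{n+1}` and
`[e_i, e_j] = ∑_k f^k_{ij} e_k - 2 σ_{ij} e_{n+1}`. -/
structure IntegrabilityData {φ : M → N} (A : AdaptedFrame n φ) where
  /-- the functions `F^k_{ij}` on the base -/
  F : Fin n → Fin n → Fin n → N → ℝ
  /-- the functions `κ_i` -/
  κ : Fin n → M → ℝ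
  /-- the functions `σ_{ij}` -/
  σ : Fin n → Fin n → M → ℝ
  contMDiffOn_F : ∀ i j k, ContMDiffOn (𝓡 n) 𝓘(ℝ, ℝ) ∞ (F i j k) A.base
  contMDiffOn_κ : ∀ i, ContMDiffOn (𝓡 (n + 1)) 𝓘(ℝ, ℝ) ∞ (κ i) A.domain
  contMDiffOn_σ : ∀ i j, ContMDiffOn (𝓡 (n + 1)) 𝓘(ℝ, ℝ) ∞ (σ i j) A.domain
  bracket_ε : ∀ y ∈ A.base, ∀ i j,
    VectorField.mlieBracket (𝓡 n) (A.ε i) (A.ε j) y = ∑ k, F i j k y • A.ε k y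
  bracket_vertical : ∀ x ∈ A.domain, ∀ i : Fin n,
    VectorField.mlieBracket (𝓡 (n + 1)) (A.e i.castSucc) (A.e (Fin.last n)) x
      = κ i x • A.e (Fin.last n) x
  bracket_horizontal : ∀ x ∈ A.domain, ∀ i j : Fin n,
    VectorField.mlieBracket (𝓡 (n + 1)) (A.e i.castSucc) (A.e j.castSucc) x
      = ∑ k : Fin n, F i j k (φ x) • A.e k.castSucc x - (2 * σ i j x) • A.e (Fin.last n) x

/-- The functions `f^k_{ij} = F^k_{ij} ∘ φ` on `M`; `D.f i j k` is `f^k_{ij}`. -/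
def IntegrabilityData.f {φ : M → N} {A : AdaptedFrame n φ} (D : IntegrabilityData A)
    (i j k : Fin n) (x : M) : ℝ :=
  D.F i j k (φ x)

/-- The functions `P^k_{ij} = (-f^j_{ik} - f^i_{jk} + f^k_{ij}) / 2`; `D.P i j k` is `P^k_{ij}`. -/
def IntegrabilityData.P {φ : M → N} {A : AdaptedFrame n φ} (D : IntegrabilityData A)
    (i j k : Fin n) (x : M) : ℝ :=
  (1 / 2 : ℝ) * (-D.f i k j x - D.f j k i x + D.f i j k x)

/-- The derivative `e_i(u)` at `x` of a function `u` along the `i`-th horizontal frame field. -/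
def AdaptedFrame.along {φ : M → N} (A : AdaptedFrame n φ) (i : Fin n) (u : M → ℝ) (x : M) : ℝ :=
  mvfderiv (𝓡 (n + 1)) u x (A.e i.castSucc x)

end Frames

end

end RiemSubm

namespace RiemSubm

set_option linter.unusedSectionVars false

noncomputable section

section DirectionalDerivative

variable {E : Type*} [NormedAddCommGroup E] [NormedSpace ℝ E]
  {H : Type*} [TopologicalSpace H] {I : ModelWithCorners ℝ E H}
  {M : Type*} [TopologicalSpace M] [ChartedSpace H M]
  {F : Type*} [NormedAddCommGroup F] [NormedSpace ℝ F]

theorem mvfderiv_congr {f g : M → F} {x : M} (h : f =ᶠ[nhds x] g) :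
    mvfderiv I f x = mvfderiv I g x := by
  simp only [mvfderiv]
  rw [h.mfderiv_eq, h.eq_of_nhds]

theorem mdifferentiableAt_sum {ι : Type*} (s : Finset ι) {f : ι → M → F} {x : M}
    (hf : ∀ i ∈ s, MDiffAt (f i) x) : MDiffAt (fun y => ∑ i ∈ s, f i y) x := by
  classical
  induction s using Finset.induction_on with
  | empty => simpa using mdifferentiableAt_const
  | insert a s ha ih =>
    simp only [Finset.mem_insert, forall_eq_or_imp] at hf
    simp only [Finset.sum_insert ha]
    exact hf.1.add (ih hf.2)

theorem mvfderiv_sum {ι : Type*} (s : Finset ι) {f : ι → M → F} {x : M}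
    (hf : ∀ i ∈ s, MDiffAt (f i) x) :
    mvfderiv I (fun y => ∑ i ∈ s, f i y) x = ∑ i ∈ s, mvfderiv I (f i) x := by
  classical
  induction s using Finset.induction_on with
  | empty => simpa using mvfderiv_const (I := I) (0 : F) (x := x)
  | insert a s ha ih =>
    simp only [Finset.mem_insert, forall_eq_or_imp] at hf
    simp only [Finset.sum_insert ha, ← ih hf.2]
    exact mvfderiv_add hf.1 (mdifferentiableAt_sum s hf.2)

theorem eventually_mdifferentiableAt [IsManifold I 1 M]
    {E' : Type*} [NormedAddCommGroup E'] [NormedSpace ℝ E']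
    {H' : Type*} [TopologicalSpace H'] {J : ModelWithCorners ℝ E' H'}
    {N : Type*} [TopologicalSpace N] [ChartedSpace H' N] [IsManifold J 1 N] {f : M → N} {x : M}
    (hf : ContMDiffAt I J ∞ f x) : ∀ᶠ y in nhds x, MDiffAt f y := by
  have h1 : ContMDiffAt I J 1 f x := hf.of_le (by simp)
  exact ((contMDiffAt_iff_contMDiffAt_nhds (by simp)).1 h1).mono
    fun y hy => hy.mdifferentiableAt one_ne_zero

/-- The derivative of a smooth function along a smooth vector field is smooth. -/
theorem contMDiffAt_mvfderiv_apply [IsManifold I ∞ M] {f : M → ℝ} {X : Π x : M, TangentSpace I x}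
    {x : M} (hf : ContMDiffAt I 𝓘(ℝ, ℝ) ∞ f x) (hX : CMDiffAt ∞ (T% X) x) :
    ContMDiffAt I 𝓘(ℝ, ℝ) ∞ (fun y => mvfderiv I f y (X y)) x := by
  have h1 := hf.mfderiv_const (m := ∞) (n := ∞) (by simp)
  have h2 : ContMDiffAt I 𝓘(ℝ, ℝ).tangent ∞
      (fun y => (⟨f y, mfderiv I 𝓘(ℝ, ℝ) f y (X y)⟩ : TangentBundle 𝓘(ℝ, ℝ) ℝ)) x :=
    ContMDiffAt.clm_apply_of_inCoordinates h1 hX hf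
  exact (contMDiff_snd_tangentBundle_modelSpace ℝ 𝓘(ℝ, ℝ)).contMDiffAt.comp x h2

/-- The Lie bracket acts on functions as the commutator of derivations. -/
theorem mvfderiv_mlieBracket [IsManifold I ∞ M] [FiniteDimensional ℝ E]
    {f : M → ℝ} {X Y : Π x : M, TangentSpace I x}
    {x : M} (hf : ContMDiffAt I 𝓘(ℝ, ℝ) ∞ f x) (hX : CMDiffAt ∞ (T% X) x)
    (hY : CMDiffAt ∞ (T% Y) x) :
    mvfderiv I f x (VectorField.mlieBracket I X Y x)
      = mvfderiv I (fun y => mvfderiv I f y (Y y)) x (X x)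
        - mvfderiv I (fun y => mvfderiv I f y (X y)) x (Y x) := by
  have h2 : IsManifold I (minSmoothness ℝ 2) M := by
    simpa using (inferInstance : IsManifold I 2 M)
  have h3 : IsManifold I (minSmoothness ℝ 3) M := by
    simpa using (inferInstance : IsManifold I 3 M)
  rcases subsingleton_or_nontrivial E with hE | hE
  · have h0 (u : TangentSpace I x) : u = 0 := Subsingleton.elim (α := E) u 0
    rw [h0 (X x), h0 (Y x), h0 (VectorField.mlieBracket I X Y x)]
    simp
  have hs : minSmoothness ℝ 2 ≤ (∞ : WithTop ℕ∞) := by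
    simpa using (WithTop.coe_le_coe.mpr le_top : ((2 : ℕ∞) : WithTop ℕ∞) ≤ ∞)
  have hM : IsManifold I (((⊤ : ℕ∞) : WithTop ℕ∞) + 1) M := inferInstanceAs (IsManifold I ∞ M)
  obtain ⟨v, hv⟩ := exists_ne (0 : E)
  change TangentSpace I x at v
  set Z := FiberBundle.extend E v
  have hZ : CMDiffAt ∞ (T% Z) x := FiberBundle.contMDiffAt_extend I E v
  have hZx : Z x = v := by simp [Z]
  have hd {U : Π x : M, TangentSpace I x} (hU : CMDiffAt ∞ (T% U) x) : MDiffAt (T% U) x :=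
    hU.mdifferentiableAt (by simp)
  have hb {U V : Π x : M, TangentSpace I x} (hU : CMDiffAt ∞ (T% U) x)
      (hV : CMDiffAt ∞ (T% V) x) : CMDiffAt ∞ (T% (VectorField.mlieBracket I U V)) x :=
    ContMDiffAt.mlieBracket_vectorField (m := ⊤) (n := ⊤) hU hV (by simp)
  have hf' : ∀ᶠ y in nhds x, MDiffAt f y :=
    eventually_mdifferentiableAt hf
  have hZ' : ∀ᶠ y in nhds x, MDiffAt (T% Z) y :=
    eventually_mdifferentiableAt hZ
  have key (V : Π x : M, TangentSpace I x) : VectorField.mlieBracket I V (f • Z) =ᶠ[nhds x]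
      (fun y => mvfderiv I f y (V y)) • Z + f • VectorField.mlieBracket I V Z := by
    filter_upwards [hf', hZ'] with y hy hy'
    exact VectorField.mlieBracket_smul_right hy hy'
  have J := VectorField.leibniz_identity_mlieBracket_apply (hX.of_le hs) (hY.of_le hs)
    ((hf.smul_section hZ).of_le hs)
  have JZ := VectorField.leibniz_identity_mlieBracket_apply (hX.of_le hs) (hY.of_le hs)
    (hZ.of_le hs)
  have second {U V : Π x : M, TangentSpace I x} (hV : CMDiffAt ∞ (T% V) x) :
      VectorField.mlieBracket I U (VectorField.mlieBracket I V (f • Z)) x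
        = mvfderiv I (fun y => mvfderiv I f y (V y)) x (U x) • v
          + mvfderiv I f x (V x) • VectorField.mlieBracket I U Z x
          + (mvfderiv I f x (U x) • VectorField.mlieBracket I V Z x
            + f x • VectorField.mlieBracket I U (VectorField.mlieBracket I V Z) x) := by
    have h1 : MDiffAt (fun y => mvfderiv I f y (V y)) x :=
      (contMDiffAt_mvfderiv_apply hf hV).mdifferentiableAt (by simp)
    have h2 : MDiffAt f x := hf.mdifferentiableAt (by simp)
    rw [(Filter.EventuallyEq.refl _ U).mlieBracket_vectorField_eq (key V),
      VectorField.mlieBracket_add_right (h1.smul_section (hd hZ)) (h2.smul_section (hd (hb hV hZ))),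
      VectorField.mlieBracket_smul_right h1 (hd hZ),
      VectorField.mlieBracket_smul_right h2 (hd (hb hV hZ)), hZx]
  rw [second hY, second hX, (key _).eq_of_nhds, JZ] at J
  simp only [Pi.add_apply, Pi.smul_apply', hZx] at J
  have : (mvfderiv I f x (VectorField.mlieBracket I X Y x)
      - (mvfderiv I (fun y => mvfderiv I f y (Y y)) x (X x)
        - mvfderiv I (fun y => mvfderiv I f y (X y)) x (Y x))) • v = 0 := by
    rw [← sub_eq_zero] at J
    rw [← neg_eq_zero, ← J]
    module
  exact sub_eq_zero.mp ((smul_eq_zero.mp this).resolve_right hv)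

end DirectionalDerivative

section LeviCivita

variable {E : Type*} [NormedAddCommGroup E] [NormedSpace ℝ E] [FiniteDimensional ℝ E]
  {H : Type*} [TopologicalSpace H] {I : ModelWithCorners ℝ E H}
  {M : Type*} [TopologicalSpace M] [ChartedSpace H M] [IsManifold I ∞ M]
  [RiemannianBundle (fun x : M => TangentSpace I x)]
  {X X' Y Y' Z Z' : Π x : M, TangentSpace I x} {x : M}

@[simp]
theorem ext_self (v : TangentSpace I x) : ext I v x = v := by
  simp [ext]

theorem contMDiffAt_ext (v : TangentSpace I x) : CMDiffAt ∞ (T% (ext I v)) x :=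
  FiberBundle.contMDiffAt_extend I E v

theorem mdifferentiableAt_ext (v : TangentSpace I x) : MDiffAt (T% (ext I v)) x :=
  FiberBundle.mdifferentiableAt_extend I E v

theorem ext_eventuallyEq (v : TangentSpace I x) : ∀ᶠ y in nhds x,
    ext I v y = (trivializationAt E (TangentSpace I : M → Type _) x).symmₗ ℝ y
      ((trivializationAt E (TangentSpace I : M → Type _) x).linearMapAt ℝ x v) := by
  filter_upwards [(trivializationAt E (TangentSpace I : M → Type _) x).open_baseSet.mem_nhds
    (FiberBundle.mem_baseSet_trivializationAt' x)] with y hy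
  rw [Bundle.Trivialization.linearMapAt_apply, if_pos (FiberBundle.mem_baseSet_trivializationAt' x),
    Bundle.Trivialization.symmₗ_apply _ hy]
  rfl

theorem ext_add (v w : TangentSpace I x) :
    ∀ᶠ y in nhds x, ext I (v + w) y = (ext I v + ext I w) y := by
  filter_upwards [ext_eventuallyEq v, ext_eventuallyEq w, ext_eventuallyEq (v + w)] with y h1 h2 h3
  rw [Pi.add_apply, h1, h2, h3, map_add, map_add]

theorem ext_smul (c : ℝ) (v : TangentSpace I x) :
    ∀ᶠ y in nhds x, ext I (c • v) y = ((fun _ : M => c) • ext I v) y := by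
  filter_upwards [ext_eventuallyEq v, ext_eventuallyEq (c • v)] with y h1 h3
  rw [Pi.smul_apply', h1, h3, map_smul, map_smul]

theorem koszul_congr (h : Y =ᶠ[nhds x] Y') : koszul I X Y Z x = koszul I X Y' Z x := by
  simp only [koszul]
  rw [h.eq_of_nhds, (Filter.EventuallyEq.refl _ X).mlieBracket_vectorField_eq h,
    h.mlieBracket_vectorField_eq (Filter.EventuallyEq.refl _ Z),
    mvfderiv_congr (I := I) (f := fun y => inner ℝ (Y y) (Z y)) (g := fun y => inner ℝ (Y' y) (Z y))
      (h.mono fun y hy => by simp only [hy]),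
    mvfderiv_congr (I := I) (f := fun y => inner ℝ (X y) (Y y)) (g := fun y => inner ℝ (X y) (Y' y))
      (h.mono fun y hy => by simp only [hy])]

theorem leviCivita_congr (h : ∀ᶠ y in nhds x, Y y = Y' y) :
    leviCivita I Y x = leviCivita I Y' x := by
  ext v
  simp only [leviCivita, koszul_congr h]

variable [IsContMDiffRiemannianBundle I ∞ E (fun x : M => TangentSpace I x)]

theorem mdifferentiableAt_inner (hX : MDiffAt (T% X) x) (hY : MDiffAt (T% Y) x) :
    MDiffAt (fun y => inner ℝ (X y) (Y y)) x :=
  MDifferentiableAt.inner_bundle (E := fun x : M => TangentSpace I x) hX hY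

theorem contMDiffAt_inner (hX : CMDiffAt ∞ (T% X) x) (hY : CMDiffAt ∞ (T% Y) x) :
    ContMDiffAt I 𝓘(ℝ, ℝ) ∞ (fun y => inner ℝ (X y) (Y y)) x :=
  ContMDiffAt.inner_bundle (E := fun x : M => TangentSpace I x) hX hY

theorem koszul_smul_left {f : M → ℝ} (hf : MDiffAt f x) (hX : MDiffAt (T% X) x)
    (hY : MDiffAt (T% Y) x) (hZ : MDiffAt (T% Z) x) :
    koszul I (f • X) Y Z x = f x * koszul I X Y Z x := by
  simp only [koszul, Pi.smul_apply', inner_smul_left, RCLike.conj_to_real]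
  rw [mvfderiv_fun_mul hf (mdifferentiableAt_inner hX hZ), mvfderiv_fun_mul hf (mdifferentiableAt_inner hX hY),
    VectorField.mlieBracket_smul_left hf hX, VectorField.mlieBracket_smul_left hf hX]
  simp [inner_add_left, inner_smul_left, inner_smul_right]
  ring

theorem koszul_add_left (hX : MDiffAt (T% X) x) (hX' : MDiffAt (T% X') x)
    (hY : MDiffAt (T% Y) x) (hZ : MDiffAt (T% Z) x) :
    koszul I (X + X') Y Z x = koszul I X Y Z x + koszul I X' Y Z x := by
  simp only [koszul, Pi.add_apply, inner_add_left]
  rw [mvfderiv_fun_add (mdifferentiableAt_inner hX hZ) (mdifferentiableAt_inner hX' hZ),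
    mvfderiv_fun_add (mdifferentiableAt_inner hX hY) (mdifferentiableAt_inner hX' hY),
    VectorField.mlieBracket_add_left hX hX', VectorField.mlieBracket_add_left hX hX']
  simp [inner_add_left, inner_add_right]
  ring

theorem koszul_smul_right {f : M → ℝ} (hf : MDiffAt f x) (hX : MDiffAt (T% X) x)
    (hY : MDiffAt (T% Y) x) (hZ : MDiffAt (T% Z) x) :
    koszul I X Y (f • Z) x = f x * koszul I X Y Z x := by
  simp only [koszul, Pi.smul_apply', inner_smul_right]
  rw [mvfderiv_fun_mul hf (mdifferentiableAt_inner hX hZ), mvfderiv_fun_mul hf (mdifferentiableAt_inner hY hZ),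
    VectorField.mlieBracket_smul_right hf hZ, VectorField.mlieBracket_smul_right hf hZ]
  simp [inner_add_left, inner_smul_left, real_inner_comm]
  ring

theorem koszul_add_right (hX : MDiffAt (T% X) x) (hZ' : MDiffAt (T% Z') x)
    (hY : MDiffAt (T% Y) x) (hZ : MDiffAt (T% Z) x) :
    koszul I X Y (Z + Z') x = koszul I X Y Z x + koszul I X Y Z' x := by
  simp only [koszul, Pi.add_apply, inner_add_right]
  rw [mvfderiv_fun_add (mdifferentiableAt_inner hX hZ) (mdifferentiableAt_inner hX hZ'),
    mvfderiv_fun_add (mdifferentiableAt_inner hY hZ) (mdifferentiableAt_inner hY hZ'),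
    VectorField.mlieBracket_add_right hZ hZ', VectorField.mlieBracket_add_right hZ hZ']
  simp [inner_add_left]
  ring

theorem koszul_smul_middle {f : M → ℝ} (hf : MDiffAt f x) (hX : MDiffAt (T% X) x)
    (hY : MDiffAt (T% Y) x) (hZ : MDiffAt (T% Z) x) :
    koszul I X (f • Y) Z x
      = f x * koszul I X Y Z x + 2 * (mvfderiv I f x (X x) * inner ℝ (Y x) (Z x)) := by
  simp only [koszul, Pi.smul_apply', inner_smul_left, inner_smul_right, RCLike.conj_to_real]
  rw [mvfderiv_fun_mul hf (mdifferentiableAt_inner hY hZ), mvfderiv_fun_mul hf (mdifferentiableAt_inner hX hY),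
    VectorField.mlieBracket_smul_left hf hY, VectorField.mlieBracket_smul_right hf hY]
  simp [inner_add_left, inner_smul_left, real_inner_comm]
  ring

theorem koszul_add_middle (hX : MDiffAt (T% X) x) (hY' : MDiffAt (T% Y') x)
    (hY : MDiffAt (T% Y) x) (hZ : MDiffAt (T% Z) x) :
    koszul I X (Y + Y') Z x = koszul I X Y Z x + koszul I X Y' Z x := by
  simp only [koszul, Pi.add_apply, inner_add_left, inner_add_right]
  rw [mvfderiv_fun_add (mdifferentiableAt_inner hY hZ) (mdifferentiableAt_inner hY' hZ),
    mvfderiv_fun_add (mdifferentiableAt_inner hX hY) (mdifferentiableAt_inner hX hY'),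
    VectorField.mlieBracket_add_left hY hY', VectorField.mlieBracket_add_right hY hY']
  simp [inner_add_left]
  ring

theorem koszul_add_swap :
    koszul I X Y Z x + koszul I X Z Y x
      = 2 * mvfderiv I (fun y => inner ℝ (Y y) (Z y)) x (X x) := by
  simp only [koszul]
  rw [VectorField.mlieBracket_swap_apply (V := Z) (W := Y)]
  simp only [real_inner_comm, inner_neg_left]
  ring

theorem tensorialAt_koszul_left (hY : MDiffAt (T% Y) x) (hZ : MDiffAt (T% Z) x) :
    TensorialAt I E (fun X => koszul I X Y Z x) x where
  smul hf hX := koszul_smul_left hf hX hY hZ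
  add hX hX' := koszul_add_left hX hX' hY hZ

theorem tensorialAt_koszul_right (hX : MDiffAt (T% X) x) (hY : MDiffAt (T% Y) x) :
    TensorialAt I E (fun Z => koszul I X Y Z x) x where
  smul hf hZ := koszul_smul_right hf hX hY hZ
  add hZ hZ' := koszul_add_right hX hZ' hY hZ

/-- The Koszul formula. -/
theorem inner_leviCivita (hX : MDiffAt (T% X) x) (hY : MDiffAt (T% Y) x)
    (hZ : MDiffAt (T% Z) x) :
    inner ℝ (leviCivita I Y x (X x)) (Z x) = 1 / 2 * koszul I X Y Z x := by
  have hX' := mdifferentiableAt_ext (X x)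
  have hT := tensorialAt_koszul_right hX' hY
  have h : koszul I X Y Z x = koszul I (ext I (X x)) Y Z x :=
    (tensorialAt_koszul_left hY hZ).pointwise hX hX' (by simp)
  rw [h, ← TensorialAt.mkHom_apply hT hZ]
  conv_rhs => rw [← (onb I x).sum_repr' (Z x)]
  simp only [leviCivita, sum_inner, inner_smul_left, RCLike.conj_to_real, map_sum, map_smul,
    smul_eq_mul, Finset.mul_sum, TensorialAt.mkHom_apply_eq_extend]
  refine Finset.sum_congr rfl fun a _ => ?_
  simp only [ext]
  ring

theorem inner_leviCivita_ext (hY : MDiffAt (T% Y) x) (v w : TangentSpace I x) :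
    inner ℝ (leviCivita I Y x v) w = 1 / 2 * koszul I (ext I v) Y (ext I w) x := by
  simpa using inner_leviCivita (mdifferentiableAt_ext v) hY (mdifferentiableAt_ext w)

theorem leviCivita_add_apply (hY : MDiffAt (T% Y) x) (v w : TangentSpace I x) :
    leviCivita I Y x (v + w) = leviCivita I Y x v + leviCivita I Y x w := by
  refine ext_inner_right ℝ fun z => ?_
  have hv := mdifferentiableAt_ext v
  have hw := mdifferentiableAt_ext w
  have hz := mdifferentiableAt_ext z
  have h := inner_leviCivita (mdifferentiableAt_add_section hv hw) hY hz
  rw [koszul_add_left hv hw hY hz] at h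
  simp only [Pi.add_apply, ext_self] at h
  rw [h, inner_add_left, inner_leviCivita_ext hY, inner_leviCivita_ext hY]
  ring

theorem leviCivita_smul_apply (hY : MDiffAt (T% Y) x) (c : ℝ) (v : TangentSpace I x) :
    leviCivita I Y x (c • v) = c • leviCivita I Y x v := by
  refine ext_inner_right ℝ fun z => ?_
  have hv := mdifferentiableAt_ext v
  have hz := mdifferentiableAt_ext z
  have hc : MDiffAt (fun _ : M => c) x := mdifferentiableAt_const
  have h := inner_leviCivita (hc.smul_section hv) hY hz
  rw [koszul_smul_left hc hv hY hz] at h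
  simp only [Pi.smul_apply', ext_self] at h
  rw [h, inner_smul_left, inner_leviCivita_ext hY]
  simp only [RCLike.conj_to_real]
  ring

/-- The Levi-Civita connection as a linear map in the direction of differentiation. -/
def leviCivitaHom (hY : MDiffAt (T% Y) x) : TangentSpace I x →ₗ[ℝ] TangentSpace I x where
  toFun := leviCivita I Y x
  map_add' := leviCivita_add_apply hY
  map_smul' := leviCivita_smul_apply hY

theorem leviCivita_sum_apply (hY : MDiffAt (T% Y) x) {ι : Type*} (s : Finset ι)
    (v : ι → TangentSpace I x) :
    leviCivita I Y x (∑ i ∈ s, v i) = ∑ i ∈ s, leviCivita I Y x (v i) :=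
  map_sum (leviCivitaHom hY) v s

theorem leviCivita_add (hY : MDiffAt (T% Y) x) (hY' : MDiffAt (T% Y') x) (v : TangentSpace I x) :
    leviCivita I (Y + Y') x v = leviCivita I Y x v + leviCivita I Y' x v := by
  refine ext_inner_right ℝ fun z => ?_
  rw [inner_add_left, inner_leviCivita_ext (mdifferentiableAt_add_section hY hY'),
    inner_leviCivita_ext hY, inner_leviCivita_ext hY',
    koszul_add_middle (mdifferentiableAt_ext v) hY' hY (mdifferentiableAt_ext z)]
  ring

theorem leviCivita_smul {f : M → ℝ} (hf : MDiffAt f x) (hY : MDiffAt (T% Y) x)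
    (v : TangentSpace I x) :
    leviCivita I (f • Y) x v = f x • leviCivita I Y x v + mvfderiv I f x v • Y x := by
  refine ext_inner_right ℝ fun z => ?_
  rw [inner_add_left, inner_smul_left, inner_smul_left,
    inner_leviCivita_ext (hf.smul_section hY), inner_leviCivita_ext hY,
    koszul_smul_middle hf (mdifferentiableAt_ext v) hY (mdifferentiableAt_ext z)]
  simp only [RCLike.conj_to_real, ext_self]
  ring

theorem leviCivita_sum {ι : Type*} (s : Finset ι) {Y : ι → Π x : M, TangentSpace I x}
    (hY : ∀ i ∈ s, MDiffAt (T% (Y i)) x) (v : TangentSpace I x) :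
    leviCivita I (fun y => ∑ i ∈ s, Y i y) x v = ∑ i ∈ s, leviCivita I (Y i) x v := by
  classical
  induction s using Finset.induction_on with
  | empty =>
    have h := leviCivita_smul (I := I) (f := fun _ : M => (0 : ℝ)) (x := x)
      mdifferentiableAt_const (mdifferentiableAt_ext (0 : TangentSpace I x)) v
    simp only [mvfderiv_const] at h
    simp only [Finset.sum_empty]
    refine Eq.trans ?_ (h.trans (by simp))
    refine congrArg (fun W => leviCivita I W x v) ?_
    funext y
    simp
  | insert a s ha ih =>
    simp only [Finset.mem_insert, forall_eq_or_imp] at hY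
    simp only [Finset.sum_insert ha, ← ih hY.2]
    exact leviCivita_add hY.1 (.sum_section hY.2) v

/-- The Levi-Civita connection is metric. -/
theorem mvfderiv_inner (hY : MDiffAt (T% Y) x) (hZ : MDiffAt (T% Z) x) (v : TangentSpace I x) :
    mvfderiv I (fun y => inner ℝ (Y y) (Z y)) x v
      = inner ℝ (leviCivita I Y x v) (Z x) + inner ℝ (Y x) (leviCivita I Z x v) := by
  have hv := mdifferentiableAt_ext v
  have h1 := inner_leviCivita hv hY hZ
  have h2 := inner_leviCivita hv hZ hY
  have h3 := koszul_add_swap (I := I) (X := ext I v) (Y := Y) (Z := Z) (x := x)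
  rw [ext_self] at h1 h2 h3
  rw [real_inner_comm (leviCivita I Z x v), h1, h2]
  linarith

theorem contMDiffAt_koszul (hX : CMDiffAt ∞ (T% X) x) (hY : CMDiffAt ∞ (T% Y) x)
    (hZ : CMDiffAt ∞ (T% Z) x) :
    ContMDiffAt I 𝓘(ℝ, ℝ) ∞ (koszul I X Y Z) x := by
  have hb {U V : Π x : M, TangentSpace I x} (hU : CMDiffAt ∞ (T% U) x)
      (hV : CMDiffAt ∞ (T% V) x) : CMDiffAt ∞ (T% (VectorField.mlieBracket I U V)) x :=
    haveI : IsManifold I (minSmoothness ℝ 2) M := by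
      simpa using (inferInstance : IsManifold I 2 M)
    haveI : IsManifold I (((⊤ : ℕ∞) : WithTop ℕ∞) + 1) M := inferInstanceAs (IsManifold I ∞ M)
    ContMDiffAt.mlieBracket_vectorField (m := ⊤) (n := ⊤) hU hV (by simp)
  unfold koszul
  exact (((((contMDiffAt_mvfderiv_apply (contMDiffAt_inner hY hZ) hX).add
    (contMDiffAt_mvfderiv_apply (contMDiffAt_inner hX hZ) hY)).sub
    (contMDiffAt_mvfderiv_apply (contMDiffAt_inner hX hY) hZ)).add
    (contMDiffAt_inner (hb hX hY) hZ)).sub (contMDiffAt_inner (hb hX hZ) hY)).sub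
    (contMDiffAt_inner (hb hY hZ) hX)

end LeviCivita

section Trace

variable {V : Type*} [NormedAddCommGroup V] [InnerProductSpace ℝ V]
  {ι κ : Type*} [Fintype ι] [Fintype κ]

/-- The trace of a bilinear map does not depend on the orthonormal basis. -/
theorem sum_bilin_orthonormalBasis (B : V →ₗ[ℝ] V →ₗ[ℝ] ℝ) (b : OrthonormalBasis ι ℝ V)
    (b' : OrthonormalBasis κ ℝ V) : ∑ i, B (b i) (b i) = ∑ j, B (b' j) (b' j) := by
  have h1 (i : ι) : B (b i) (b i) = ∑ j, inner ℝ (b' j) (b i) * B (b' j) (b i) := by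
    have := congrArg (fun v => B v (b i)) (b'.sum_repr' (b i))
    simpa using this.symm
  have h2 (j : κ) : ∑ i, inner ℝ (b' j) (b i) * B (b' j) (b i) = B (b' j) (b' j) := by
    have := congrArg (fun v => B (b' j) v) (b.sum_repr' (b' j))
    simpa [real_inner_comm] using this
  rw [Finset.sum_congr rfl fun i _ => h1 i, Finset.sum_comm, Finset.sum_congr rfl fun j _ => h2 j]

end Trace

section Curvature

variable {E : Type*} [NormedAddCommGroup E] [NormedSpace ℝ E] [FiniteDimensional ℝ E]
  {H : Type*} [TopologicalSpace H] {I : ModelWithCorners ℝ E H}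
  {M : Type*} [TopologicalSpace M] [ChartedSpace H M] [IsManifold I ∞ M]
  [RiemannianBundle (fun x : M => TangentSpace I x)]
  [IsContMDiffRiemannianBundle I ∞ E (fun x : M => TangentSpace I x)]
  {X Y : Π x : M, TangentSpace I x} {x : M} {ι : Type*} [Fintype ι]

variable (I) in
/-- A smooth orthonormal frame of the tangent bundle on the open set `u`. -/
structure IsOrthonormalFrame (u : Set M) (s : ι → Π x : M, TangentSpace I x) : Prop where
  isOpen : IsOpen u
  contMDiffOn : ∀ i, CMDiff[u] ∞ (T% (s i))
  orthonormal : ∀ x ∈ u, Orthonormal ℝ (fun i => s i x)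
  card_eq : Fintype.card ι = Module.finrank ℝ E

namespace IsOrthonormalFrame

variable {u : Set M} {s : ι → Π x : M, TangentSpace I x}

theorem contMDiffAt (hs : IsOrthonormalFrame I u s) (hx : x ∈ u) (i : ι) :
    CMDiffAt ∞ (T% (s i)) x :=
  (hs.contMDiffOn i).contMDiffAt (hs.isOpen.mem_nhds hx)

theorem mdifferentiableAt (hs : IsOrthonormalFrame I u s) (hx : x ∈ u) (i : ι) :
    MDiffAt (T% (s i)) x :=
  (hs.contMDiffAt hx i).mdifferentiableAt (by simp)

/-- The orthonormal basis of `T_x M` given by an orthonormal frame. -/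
def basis (hs : IsOrthonormalFrame I u s) (hx : x ∈ u) :
    OrthonormalBasis ι ℝ (TangentSpace I x) :=
  OrthonormalBasis.mk (hs.orthonormal x hx)
    ((hs.orthonormal x hx).linearIndependent.span_eq_top_of_card_eq_finrank' hs.card_eq).ge

@[simp]
theorem basis_apply (hs : IsOrthonormalFrame I u s) (hx : x ∈ u) (i : ι) :
    hs.basis hx i = s i x := by
  simp [basis]

theorem sum_inner_smul (hs : IsOrthonormalFrame I u s) (hx : x ∈ u) (v : TangentSpace I x) :
    ∑ i, inner ℝ (s i x) v • s i x = v := by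
  simpa using (hs.basis hx).sum_repr' v

theorem inner_eq_ite [DecidableEq ι] (hs : IsOrthonormalFrame I u s) (hx : x ∈ u) (i j : ι) :
    inner ℝ (s i x) (s j x) = if i = j then (1 : ℝ) else 0 :=
  orthonormal_iff_ite.mp (hs.orthonormal x hx) i j

theorem eventuallyEq_sum (hs : IsOrthonormalFrame I u s) (hx : x ∈ u)
    (X : Π x : M, TangentSpace I x) :
    ∀ᶠ y in nhds x, X y = ∑ i, inner ℝ (s i y) (X y) • s i y := by
  filter_upwards [hs.isOpen.mem_nhds hx] with y hy using (hs.sum_inner_smul hy _).symm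

/-- The covariant derivative of a smooth field along a smooth field is smooth. -/
theorem contMDiffAt_leviCivita (hs : IsOrthonormalFrame I u s) (hx : x ∈ u)
    (hX : CMDiffAt ∞ (T% X) x) (hY : CMDiffAt ∞ (T% Y) x) :
    CMDiffAt ∞ (T% (fun y => leviCivita I Y y (X y))) x := by
  have h : CMDiffAt ∞ (T% (fun y => ∑ i, (1 / 2 * koszul I X Y (s i) y) • s i y)) x := by
    refine ContMDiffAt.sum_section fun i _ => ?_
    exact (contMDiffAt_const.mul (contMDiffAt_koszul hX hY (hs.contMDiffAt hx i))).smul_section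
      (hs.contMDiffAt hx i)
  refine h.congr_of_eventuallyEq ?_
  filter_upwards [hs.isOpen.mem_nhds hx, eventually_mdifferentiableAt hX,
    eventually_mdifferentiableAt hY] with y hy hX hY
  refine congrArg (Bundle.TotalSpace.mk y) ?_
  rw [← hs.sum_inner_smul hy (leviCivita I Y y (X y))]
  refine Finset.sum_congr rfl fun i _ => ?_
  rw [real_inner_comm, inner_leviCivita hX hY (hs.mdifferentiableAt hy i)]

end IsOrthonormalFrame

/-- `Y ↦ ∇_u Y` on the extensions of tangent vectors. -/
def leviCivitaExt (u : TangentSpace I x) : TangentSpace I x →ₗ[ℝ] TangentSpace I x where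
  toFun v := leviCivita I (ext I v) x u
  map_add' v w := by
    rw [leviCivita_congr (ext_add v w),
      leviCivita_add (mdifferentiableAt_ext v) (mdifferentiableAt_ext w)]
  map_smul' c v := by
    rw [leviCivita_congr (ext_smul c v), leviCivita_smul mdifferentiableAt_const
      (mdifferentiableAt_ext v), mvfderiv_const]
    simp

theorem eventually_mdifferentiableAt_ext (v : TangentSpace I x) :
    ∀ᶠ y in nhds x, MDiffAt (T% (ext I v)) y :=
  eventually_mdifferentiableAt (contMDiffAt_ext v)

section

variable {o : Set M} {s : ι → Π x : M, TangentSpace I x}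
  (hs : IsOrthonormalFrame I o s) (hx : x ∈ o)

include hs hx in
theorem mdifferentiableAt_leviCivita_ext (v w : TangentSpace I x) :
    MDiffAt (T% (fun y => leviCivita I (ext I w) y (ext I v y))) x :=
  (hs.contMDiffAt_leviCivita hx (contMDiffAt_ext v) (contMDiffAt_ext w)).mdifferentiableAt
    (by simp)

theorem curvature_swap (u v w : TangentSpace I x) :
    curvature I x u v w = -curvature I x v u w := by
  simp only [curvature]
  rw [VectorField.mlieBracket_swap_apply, ← neg_one_smul ℝ,
    leviCivita_smul_apply (mdifferentiableAt_ext w)]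
  module

include hs hx

theorem curvature_add_left (u u' v w : TangentSpace I x) :
    curvature I x (u + u') v w = curvature I x u v w + curvature I x u' v w := by
  have hw := mdifferentiableAt_ext w
  have h1 : ∀ᶠ y in nhds x, leviCivita I (ext I w) y (ext I (u + u') y)
      = ((fun y => leviCivita I (ext I w) y (ext I u y))
        + (fun y => leviCivita I (ext I w) y (ext I u' y))) y := by
    filter_upwards [ext_add u u', eventually_mdifferentiableAt_ext w] with y hy hwy
    rw [hy, Pi.add_apply, Pi.add_apply, leviCivita_add_apply hwy]
  have h2 : VectorField.mlieBracket I (ext I (u + u')) (ext I v) x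
      = VectorField.mlieBracket I (ext I u) (ext I v) x
        + VectorField.mlieBracket I (ext I u') (ext I v) x := by
    rw [← VectorField.mlieBracket_add_left (mdifferentiableAt_ext u) (mdifferentiableAt_ext u')]
    exact Filter.EventuallyEq.mlieBracket_vectorField_eq (ext_add u u') (.refl _ _)
  simp only [curvature]
  rw [leviCivita_congr h1, leviCivita_add (mdifferentiableAt_leviCivita_ext hs hx u w)
    (mdifferentiableAt_leviCivita_ext hs hx u' w), h2, leviCivita_add_apply hw,
    leviCivita_add_apply (mdifferentiableAt_leviCivita_ext hs hx v w)]
  abel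

theorem curvature_smul_left (c : ℝ) (u v w : TangentSpace I x) :
    curvature I x (c • u) v w = c • curvature I x u v w := by
  have hw := mdifferentiableAt_ext w
  have hc : MDiffAt (fun _ : M => c) x := mdifferentiableAt_const
  have h1 : ∀ᶠ y in nhds x, leviCivita I (ext I w) y (ext I (c • u) y)
      = ((fun _ : M => c) • (fun y => leviCivita I (ext I w) y (ext I u y))) y := by
    filter_upwards [ext_smul c u, eventually_mdifferentiableAt_ext w] with y hy hwy
    rw [hy, Pi.smul_apply', Pi.smul_apply', leviCivita_smul_apply hwy]
  have h2 : VectorField.mlieBracket I (ext I (c • u)) (ext I v) x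
      = c • VectorField.mlieBracket I (ext I u) (ext I v) x := by
    rw [← VectorField.mlieBracket_const_smul_left (mdifferentiableAt_ext u)]
    exact Filter.EventuallyEq.mlieBracket_vectorField_eq (ext_smul c u) (.refl _ _)
  simp only [curvature]
  rw [leviCivita_congr h1, leviCivita_smul hc (mdifferentiableAt_leviCivita_ext hs hx u w), h2,
    leviCivita_smul_apply hw, leviCivita_smul_apply (mdifferentiableAt_leviCivita_ext hs hx v w),
    mvfderiv_const]
  simp only [zero_apply, zero_smul, add_zero]
  module

theorem curvature_add_right (u v w w' : TangentSpace I x) :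
    curvature I x u v (w + w') = curvature I x u v w + curvature I x u v w' := by
  have h1 (z : TangentSpace I x) : ∀ᶠ y in nhds x, leviCivita I (ext I (w + w')) y (ext I z y)
      = ((fun y => leviCivita I (ext I w) y (ext I z y))
        + (fun y => leviCivita I (ext I w') y (ext I z y))) y := by
    filter_upwards [(ext_add w w').eventually_nhds, eventually_mdifferentiableAt_ext w,
      eventually_mdifferentiableAt_ext w'] with y hy hwy hwy'
    rw [leviCivita_congr hy, Pi.add_apply, leviCivita_add hwy hwy']
  simp only [curvature]
  rw [leviCivita_congr (h1 u), leviCivita_congr (h1 v), leviCivita_congr (ext_add w w'),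
    leviCivita_add (mdifferentiableAt_ext w) (mdifferentiableAt_ext w'),
    leviCivita_add (mdifferentiableAt_leviCivita_ext hs hx u w)
      (mdifferentiableAt_leviCivita_ext hs hx u w'),
    leviCivita_add (mdifferentiableAt_leviCivita_ext hs hx v w)
      (mdifferentiableAt_leviCivita_ext hs hx v w')]
  abel

theorem curvature_smul_right (c : ℝ) (u v w : TangentSpace I x) :
    curvature I x u v (c • w) = c • curvature I x u v w := by
  have hc (y : M) : MDiffAt (fun _ : M => c) y := mdifferentiableAt_const
  have h1 (z : TangentSpace I x) : ∀ᶠ y in nhds x, leviCivita I (ext I (c • w)) y (ext I z y)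
      = ((fun _ : M => c) • (fun y => leviCivita I (ext I w) y (ext I z y))) y := by
    filter_upwards [(ext_smul c w).eventually_nhds, eventually_mdifferentiableAt_ext w]
      with y hy hwy
    rw [leviCivita_congr hy, Pi.smul_apply', leviCivita_smul (hc y) hwy, mvfderiv_const]
    simp
  simp only [curvature]
  rw [leviCivita_congr (h1 u), leviCivita_congr (h1 v), leviCivita_congr (ext_smul c w),
    leviCivita_smul (hc x) (mdifferentiableAt_ext w),
    leviCivita_smul (hc x) (mdifferentiableAt_leviCivita_ext hs hx u w),
    leviCivita_smul (hc x) (mdifferentiableAt_leviCivita_ext hs hx v w), mvfderiv_const]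
  simp only [zero_apply, zero_smul, add_zero]
  module

theorem inner_curvature_self (u v w : TangentSpace I x) :
    inner ℝ (curvature I x u v w) w = 0 := by
  have hw := mdifferentiableAt_ext w
  let f : M → ℝ := fun y => inner ℝ (ext I w y) (ext I w y)
  have hf : ContMDiffAt I 𝓘(ℝ, ℝ) ∞ f x :=
    contMDiffAt_inner (contMDiffAt_ext w) (contMDiffAt_ext w)
  have hfy : ∀ᶠ y in nhds x, ∀ z : TangentSpace I y,
      mvfderiv I f y z = 2 * inner ℝ (leviCivita I (ext I w) y z) (ext I w y) := by
    filter_upwards [eventually_mdifferentiableAt_ext w] with y hy z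
    rw [mvfderiv_inner hy hy, real_inner_comm (leviCivita I (ext I w) y z)]
    ring
  have second (z z' : TangentSpace I x) :
      mvfderiv I (fun y => mvfderiv I f y (ext I z y)) x z'
        = 2 * (inner ℝ (leviCivita I (fun y => leviCivita I (ext I w) y (ext I z y)) x z') w
          + inner ℝ (leviCivita I (ext I w) x z) (leviCivita I (ext I w) x z')) := by
    have hz := mdifferentiableAt_leviCivita_ext hs hx z w
    have h1 : (fun y => mvfderiv I f y (ext I z y)) =ᶠ[nhds x]
        fun y => 2 * inner ℝ (leviCivita I (ext I w) y (ext I z y)) (ext I w y) := by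
      filter_upwards [hfy] with y hy using hy _
    rw [mvfderiv_congr h1,
      mvfderiv_fun_mul mdifferentiableAt_const (mdifferentiableAt_inner hz hw), mvfderiv_const]
    simp only [smul_zero, add_zero, smul_apply, smul_eq_mul]
    rw [mvfderiv_inner hz hw, ext_self, ext_self]
  have hb := mvfderiv_mlieBracket hf (contMDiffAt_ext u) (contMDiffAt_ext v)
  rw [hfy.self_of_nhds, ext_self, ext_self, ext_self, second, second,
    real_inner_comm (leviCivita I (ext I w) x v) (leviCivita I (ext I w) x u)] at hb
  simp only [curvature, inner_sub_left]
  linarith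

theorem inner_curvature_swap (u v w z : TangentSpace I x) :
    inner ℝ (curvature I x u v w) z = -inner ℝ (curvature I x u v z) w := by
  have h := inner_curvature_self hs hx u v (w + z)
  rw [curvature_add_right hs hx] at h
  simp only [inner_add_left, inner_add_right, inner_curvature_self hs hx] at h
  linarith

end

end Curvature

section Divergence

variable {E : Type*} [NormedAddCommGroup E] [NormedSpace ℝ E] [FiniteDimensional ℝ E]
  {H : Type*} [TopologicalSpace H] {I : ModelWithCorners ℝ E H}
  {M : Type*} [TopologicalSpace M] [ChartedSpace H M] [IsManifold I ∞ M]
  [RiemannianBundle (fun x : M => TangentSpace I x)]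
  [IsContMDiffRiemannianBundle I ∞ E (fun x : M => TangentSpace I x)]
  {x : M} {ι : Type*} [Fintype ι] {u : Set M} {s : ι → Π x : M, TangentSpace I x}

/-- The covariant derivative `(∇_v G)(w)` of a differential form, in terms of a frame. -/
theorem IsOrthonormalFrame.covDeriv_form (hs : IsOrthonormalFrame I u s) (hx : x ∈ u)
    (G : Π y : M, TangentSpace I y →ₗ[ℝ] ℝ) (hG : ∀ i, MDiffAt (fun y => G y (s i y)) x)
    (v w : TangentSpace I x) :
    mvfderiv I (fun y => G y (ext I w y)) x v - G x (leviCivita I (ext I w) x v)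
      = ∑ i, inner ℝ (s i x) w *
        (mvfderiv I (fun y => G y (s i y)) x v - G x (leviCivita I (s i) x v)) := by
  have hc (i : ι) : MDiffAt (fun y => inner ℝ (s i y) (ext I w y)) x :=
    mdifferentiableAt_inner (hs.mdifferentiableAt hx i) (mdifferentiableAt_ext w)
  have h := hs.eventuallyEq_sum hx (ext I w)
  have h1 : (fun y => G y (ext I w y)) =ᶠ[nhds x]
      fun y => ∑ i, inner ℝ (s i y) (ext I w y) * G y (s i y) := by
    filter_upwards [h] with y hy
    refine (congrArg (G y) hy).trans ?_
    simp
  have h2 : leviCivita I (ext I w) x v = ∑ i, (inner ℝ (s i x) w • leviCivita I (s i) x v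
      + mvfderiv I (fun y => inner ℝ (s i y) (ext I w y)) x v • s i x) := by
    rw [leviCivita_congr h]
    refine (leviCivita_sum Finset.univ
      (fun i _ => (hc i).smul_section (hs.mdifferentiableAt hx i)) v).trans ?_
    refine Finset.sum_congr rfl fun i _ => ?_
    refine (leviCivita_smul (hc i) (hs.mdifferentiableAt hx i) v).trans ?_
    rw [ext_self]
  have h3 := mvfderiv_sum Finset.univ
    (f := fun i y => inner ℝ (s i y) (ext I w y) * G y (s i y)) fun i _ => (hc i).mul (hG i)
  rw [mvfderiv_congr h1, h3, h2]
  simp only [map_sum, map_add, map_smul, sum_apply, ← Finset.sum_sub_distrib]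
  refine Finset.sum_congr rfl fun i _ => ?_
  rw [mvfderiv_fun_mul (hc i) (hG i)]
  simp
  ring

/-- The trace of the covariant derivative of a differential form, in terms of a frame. -/
theorem IsOrthonormalFrame.sum_covDeriv_form (hs : IsOrthonormalFrame I u s) (hx : x ∈ u)
    (G : Π y : M, TangentSpace I y →ₗ[ℝ] ℝ) (hG : ∀ i, MDiffAt (fun y => G y (s i y)) x) :
    ∑ a, (mvfderiv I (fun y => G y (ext I (onb I x a) y)) x (onb I x a)
        - G x (leviCivita I (ext I (onb I x a)) x (onb I x a)))
      = ∑ i, (mvfderiv I (fun y => G y (s i y)) x (s i x)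
        - G x (leviCivita I (s i) x (s i x))) := by
  classical
  let L (i : ι) : TangentSpace I x →ₗ[ℝ] ℝ :=
    (mvfderiv I (fun y => G y (s i y)) x).toLinearMap
      - (G x).comp (leviCivitaHom (hs.mdifferentiableAt hx i))
  let B : TangentSpace I x →ₗ[ℝ] TangentSpace I x →ₗ[ℝ] ℝ :=
    ∑ i, LinearMap.smulRight (innerₛₗ ℝ (s i x)) (L i)
  have hB (v w : TangentSpace I x) : B w v = ∑ i, inner ℝ (s i x) w *
      (mvfderiv I (fun y => G y (s i y)) x v - G x (leviCivita I (s i) x v)) := by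
    simp [B, L, LinearMap.sum_apply]
    rfl
  simp only [hs.covDeriv_form hx G hG, ← hB]
  rw [sum_bilin_orthonormalBasis B (onb I x) (hs.basis hx)]
  refine Finset.sum_congr rfl fun j _ => ?_
  simp [hB, hs.inner_eq_ite hx]

end Divergence

section Chain

variable {E : Type*} [NormedAddCommGroup E] [NormedSpace ℝ E]
  {H : Type*} [TopologicalSpace H] {I : ModelWithCorners ℝ E H}
  {M : Type*} [TopologicalSpace M] [ChartedSpace H M]
  {E' : Type*} [NormedAddCommGroup E'] [NormedSpace ℝ E']
  {H' : Type*} [TopologicalSpace H'] {J : ModelWithCorners ℝ E' H'}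
  {N : Type*} [TopologicalSpace N] [ChartedSpace H' N]
  {F F' : Type*} [NormedAddCommGroup F] [NormedSpace ℝ F]
  [NormedAddCommGroup F'] [NormedSpace ℝ F']

theorem mvfderiv_comp_map {g : N → F} {φ : M → N} {x : M} (hg : MDiffAt g (φ x))
    (hφ : MDiffAt φ x) (v : TangentSpace I x) :
    mvfderiv I (fun y => g (φ y)) x v = mvfderiv J g (φ x) (mfderiv I J φ x v) := by
  have h := mfderiv_comp x hg hφ
  change (NormedSpace.fromTangentSpace _) (mfderiv I 𝓘(ℝ, F) (g ∘ φ) x v) = _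
  rw [h]
  rfl

theorem mvfderiv_clm_comp (L : F →L[ℝ] F') {g : M → F} {x : M} (hg : MDiffAt g x)
    (v : TangentSpace I x) :
    mvfderiv I (fun y => L (g y)) x v = L (mvfderiv I g x v) := by
  have hL : MDiffAt L (g x) := L.mdifferentiableAt
  have h := mfderiv_comp x hL hg
  change (NormedSpace.fromTangentSpace _) (mfderiv I 𝓘(ℝ, F') (L ∘ g) x v) = _
  rw [h, L.mfderiv_eq]
  rfl

theorem mdifferentiableAt_clm_comp (L : F →L[ℝ] F') {g : M → F} {x : M} (hg : MDiffAt g x) :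
    MDiffAt (fun y => L (g y)) x :=
  MDifferentiableAt.comp x L.mdifferentiableAt hg

end Chain

section Pullback

variable {E : Type*} [NormedAddCommGroup E] [NormedSpace ℝ E] [FiniteDimensional ℝ E]
  {H : Type*} [TopologicalSpace H] {I : ModelWithCorners ℝ E H}
  {M : Type*} [TopologicalSpace M] [ChartedSpace H M] [IsManifold I ∞ M]
  {E' : Type*} [NormedAddCommGroup E'] [NormedSpace ℝ E'] [FiniteDimensional ℝ E']
  {H' : Type*} [TopologicalSpace H'] {J : ModelWithCorners ℝ E' H'}
  {N : Type*} [TopologicalSpace N] [ChartedSpace H' N] [IsManifold J ∞ N]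
  [RiemannianBundle (fun y : N => TangentSpace J y)]
  [IsContMDiffRiemannianBundle J ∞ E' (fun y : N => TangentSpace J y)]

/-- The Levi-Civita connection in the preferred chart: derivative of the coefficients plus the
connection applied to the field with constant coefficients. -/
theorem leviCivita_eq_coord {z : N} {Y : Π y : N, TangentSpace J y} (hY : MDiffAt (T% Y) z)
    (v : TangentSpace J z) :
    leviCivita J Y z v
      = (trivializationAt E' (TangentSpace J : N → Type _) z).symmₗ ℝ z (mvfderiv J (fun y =>
          ((trivializationAt E' (TangentSpace J : N → Type _) z)
            (⟨y, Y y⟩ : TangentBundle J N)).2) z v)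
        + leviCivita J (ext J (Y z)) z v := by
  set T := trivializationAt E' (TangentSpace J : N → Type _) z with hT
  have hz : z ∈ T.baseSet := FiberBundle.mem_baseSet_trivializationAt' z
  let b := Module.finBasis ℝ E'
  let d (γ : Fin (Module.finrank ℝ E')) : TangentSpace J z := T.symmₗ ℝ z (b γ)
  let C : N → E' := fun y => (T (⟨y, Y y⟩ : TangentBundle J N)).2
  let L (γ : Fin (Module.finrank ℝ E')) : E' →L[ℝ] ℝ := (b.coord γ).toContinuousLinearMap
  have hC : MDiffAt C z := (mdifferentiableAt_section J Y).1 hY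
  have hY' : ∀ᶠ y in nhds z, Y y = ∑ γ, L γ (C y) • ext J (d γ) y := by
    filter_upwards [T.open_baseSet.mem_nhds hz, Filter.eventually_all.2
      fun γ => ext_eventuallyEq (d γ)] with y hy hd
    have h1 : C y = T.linearMapAt ℝ y (Y y) := by
      rw [Bundle.Trivialization.linearMapAt_apply, if_pos hy]
    have h2 (γ) : ext J (d γ) y = T.symmₗ ℝ y (b γ) := by
      rw [hd γ]
      simp only [d]
      rw [Bundle.Trivialization.linearMapAt_symmₗ _ hz]
    simp only [h2]
    rw [← T.symmₗ_linearMapAt (R := ℝ) hy (Y y), ← h1]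
    refine (congrArg (T.symmₗ ℝ y) (b.sum_repr (C y)).symm).trans ?_
    simp only [map_sum, map_smul]
    rfl
  have h1 := leviCivita_sum (I := J) Finset.univ (Y := fun γ => (fun y => L γ (C y)) • ext J (d γ))
    (x := z) (fun γ _ => (mdifferentiableAt_clm_comp (L γ) hC).smul_section
      (mdifferentiableAt_ext (d γ))) v
  have hYz : Y z = ∑ γ, L γ (C z) • d γ := by simpa using hY'.self_of_nhds
  have h2 : leviCivita J (ext J (Y z)) z v = ∑ γ, L γ (C z) • leviCivita J (ext J (d γ)) z v := by
    change leviCivitaExt v (Y z) = _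
    rw [hYz, map_sum]
    simp only [map_smul]
    rfl
  have h3 : T.symmₗ ℝ z (mvfderiv J C z v) = ∑ γ, L γ (mvfderiv J C z v) • d γ := by
    refine (congrArg (T.symmₗ ℝ z) (b.sum_repr (mvfderiv J C z v)).symm).trans ?_
    simp only [map_sum, map_smul]
    rfl
  rw [leviCivita_congr hY', h2]
  refine h1.trans ?_
  change _ = T.symmₗ ℝ z (mvfderiv J C z v) + _
  rw [h3, ← Finset.sum_add_distrib]
  refine Finset.sum_congr rfl fun γ _ => ?_
  rw [leviCivita_smul (mdifferentiableAt_clm_comp (L γ) hC) (mdifferentiableAt_ext (d γ)),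
    mvfderiv_clm_comp (L γ) hC, ext_self, add_comm]

/-- The pull-back connection in terms of a frame of `N`. -/
theorem pullbackConn_eq_sum {φ : M → N} {x : M} (hφ : MDiffAt φ x) {ι : Type*} [Fintype ι]
    {u : Set N} {s : ι → Π y : N, TangentSpace J y} (hs : IsOrthonormalFrame J u s)
    (hx : φ x ∈ u) {W : Π x : M, TangentSpace J (φ x)} {w : ι → M → ℝ}
    (hw : ∀ k, MDiffAt (w k) x) (hW : ∀ᶠ y in nhds x, W y = ∑ k, w k y • s k (φ y))
    (v : TangentSpace I x) :
    pullbackConn I J φ W x v = ∑ k, (mvfderiv I (w k) x v • s k (φ x)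
      + w k x • leviCivita J (s k) (φ x) (mfderiv I J φ x v)) := by
  set T := trivializationAt E' (TangentSpace J : N → Type _) (φ x) with hT
  have hz : φ x ∈ T.baseSet := FiberBundle.mem_baseSet_trivializationAt' (φ x)
  let C (k : ι) : N → E' := fun z => (T (⟨z, s k z⟩ : TangentBundle J N)).2
  have hC (k : ι) : MDiffAt (C k) (φ x) :=
    (mdifferentiableAt_section J (s k)).1 (hs.mdifferentiableAt hx k)
  have hCφ (k : ι) : MDiffAt (fun y => C k (φ y)) x := MDifferentiableAt.comp (g := C k) (f := φ) x (hC k) hφ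
  have hCx (k : ι) : T.symmₗ ℝ (φ x) (C k (φ x)) = s k (φ x) := by
    have : C k (φ x) = T.linearMapAt ℝ (φ x) (s k (φ x)) := by
      rw [Bundle.Trivialization.linearMapAt_apply, if_pos hz]
    rw [this, T.symmₗ_linearMapAt hz]
  have h1 : (fun y => (T (⟨φ y, W y⟩ : TangentBundle J N)).2) =ᶠ[nhds x]
      fun y => ∑ k, w k y • C k (φ y) := by
    filter_upwards [hW, hφ.continuousAt.eventually (T.open_baseSet.mem_nhds hz)] with y hy hb
    replace hb : φ y ∈ T.baseSet := hb
    have h (v : TangentSpace J (φ y)) :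
        (T (⟨φ y, v⟩ : TangentBundle J N)).2 = T.linearMapAt ℝ (φ y) v := by
      rw [Bundle.Trivialization.linearMapAt_apply, if_pos hb]
    simp only [C, h, hy, map_sum, map_smul]
  have h2 := mvfderiv_sum Finset.univ (I := I) (x := x) (f := fun k y => w k y • C k (φ y))
    fun k _ => (hw k).smul (hCφ k)
  have h3 : leviCivita J (ext J (W x)) (φ x) (mfderiv I J φ x v)
      = ∑ k, w k x • leviCivita J (ext J (s k (φ x))) (φ x) (mfderiv I J φ x v) := by
    change leviCivitaExt _ (W x) = _
    rw [hW.self_of_nhds, map_sum]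
    simp only [map_smul]
    rfl
  have h4 : T.symm (φ x) = T.symmₗ ℝ (φ x) := (T.coe_symmₗ hz).symm
  rw [pullbackConn, h3, mvfderiv_congr h1, h2, h4, sum_apply, map_sum, ← Finset.sum_add_distrib]
  refine Finset.sum_congr rfl fun k _ => ?_
  rw [leviCivita_eq_coord (hs.mdifferentiableAt hx k), mvfderiv_fun_smul (hw k) (hCφ k)]
  simp only [add_apply, smul_apply, ContinuousLinearMap.smulRight_apply, map_add, map_smul, hCx,
    mvfderiv_comp_map (hC k) hφ]
  simp only [C]
  module

end Pullback

section FrameFormulas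

variable {E : Type*} [NormedAddCommGroup E] [NormedSpace ℝ E] [FiniteDimensional ℝ E]
  {H : Type*} [TopologicalSpace H] {I : ModelWithCorners ℝ E H}
  {M : Type*} [TopologicalSpace M] [ChartedSpace H M] [IsManifold I ∞ M]
  [RiemannianBundle (fun x : M => TangentSpace I x)]
  [IsContMDiffRiemannianBundle I ∞ E (fun x : M => TangentSpace I x)]
  {x : M} {ι : Type*} [Fintype ι] {u : Set M} {s : ι → Π x : M, TangentSpace I x}

namespace IsOrthonormalFrame

theorem ext_of_inner (hs : IsOrthonormalFrame I u s) (hx : x ∈ u) {v w : TangentSpace I x}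
    (h : ∀ i, inner ℝ (s i x) v = inner ℝ (s i x) w) : v = w := by
  rw [← hs.sum_inner_smul hx v, ← hs.sum_inner_smul hx w]
  simp only [h]

theorem mvfderiv_inner_eq_zero (hs : IsOrthonormalFrame I u s) (hx : x ∈ u) (i j : ι) :
    mvfderiv I (fun y => inner ℝ (s i y) (s j y)) x = 0 := by
  classical
  have h : (fun y => (inner ℝ (s i y) (s j y) : ℝ)) =ᶠ[nhds x]
      fun _ => if i = j then (1 : ℝ) else 0 := by
    filter_upwards [hs.isOpen.mem_nhds hx] with y hy using hs.inner_eq_ite hy i j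
  rw [mvfderiv_congr h, mvfderiv_const]

/-- The Koszul formula in an orthonormal frame. -/
theorem inner_leviCivita (hs : IsOrthonormalFrame I u s) (hx : x ∈ u) (i j k : ι) :
    inner ℝ (s k x) (leviCivita I (s j) x (s i x))
      = 1 / 2 * (inner ℝ (s k x) (VectorField.mlieBracket I (s i) (s j) x)
        - inner ℝ (s j x) (VectorField.mlieBracket I (s i) (s k) x)
        - inner ℝ (s i x) (VectorField.mlieBracket I (s j) (s k) x)) := by
  rw [real_inner_comm, RiemSubm.inner_leviCivita (hs.mdifferentiableAt hx i)
    (hs.mdifferentiableAt hx j) (hs.mdifferentiableAt hx k)]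
  simp only [koszul, hs.mvfderiv_inner_eq_zero hx, zero_apply]
  rw [real_inner_comm (s k x), real_inner_comm (s j x), real_inner_comm (s i x)]
  ring

theorem mdifferentiableAt_form (hs : IsOrthonormalFrame I u s) (hx : x ∈ u)
    {G : Π y : M, TangentSpace I y →ₗ[ℝ] ℝ} (hG : ∀ i, MDiffAt (fun y => G y (s i y)) x)
    {X : Π y : M, TangentSpace I y} (hX : MDiffAt (T% X) x) :
    MDiffAt (fun y => G y (X y)) x := by
  have h : MDiffAt (fun y => ∑ i, inner ℝ (s i y) (X y) * G y (s i y)) x :=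
    mdifferentiableAt_sum Finset.univ fun i _ =>
      (mdifferentiableAt_inner (hs.mdifferentiableAt hx i) hX).mul (hG i)
  refine h.congr_of_eventuallyEq ?_
  filter_upwards [hs.eventuallyEq_sum hx X] with y hy
  refine (congrArg (G y) hy).trans ?_
  simp

theorem laplacian_eq (hs : IsOrthonormalFrame I u s) (hx : x ∈ u) {f : M → ℝ}
    (hf : ContMDiffAt I 𝓘(ℝ, ℝ) ∞ f x) :
    laplacian I f x = ∑ i, (mvfderiv I (fun y => mvfderiv I f y (s i y)) x (s i x)
      - mvfderiv I f x (leviCivita I (s i) x (s i x))) :=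
  hs.sum_covDeriv_form hx (fun y => (mvfderiv I f y).toLinearMap) fun i =>
    (contMDiffAt_mvfderiv_apply hf (hs.contMDiffAt hx i)).mdifferentiableAt (by simp)

/-- The bilinear form `(u, w) ↦ ⟨z, R(u, v) w⟩`. -/
def curvatureForm (hs : IsOrthonormalFrame I u s) (hx : x ∈ u) (v z : TangentSpace I x) :
    TangentSpace I x →ₗ[ℝ] TangentSpace I x →ₗ[ℝ] ℝ :=
  LinearMap.mk₂ ℝ (fun u w => inner ℝ z (curvature I x u v w))
    (fun u u' w => by rw [curvature_add_left hs hx, inner_add_right])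
    (fun c u w => by rw [curvature_smul_left hs hx, inner_smul_right, smul_eq_mul])
    (fun u w w' => by rw [curvature_add_right hs hx, inner_add_right])
    (fun c u w => by rw [curvature_smul_right hs hx, inner_smul_right, smul_eq_mul])

@[simp]
theorem curvatureForm_apply (hs : IsOrthonormalFrame I u s) (hx : x ∈ u)
    (u' v w z : TangentSpace I x) :
    hs.curvatureForm hx v z u' w = inner ℝ z (curvature I x u' v w) := rfl

theorem curvature_neg_middle (hs : IsOrthonormalFrame I u s) (hx : x ∈ u)
    (u' v w : TangentSpace I x) : curvature I x u' (-v) w = -curvature I x u' v w := by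
  rw [curvature_swap, curvature_swap u', ← neg_one_smul ℝ v, curvature_smul_left hs hx]
  simp

theorem ricci_eq (hs : IsOrthonormalFrame I u s) (hx : x ∈ u) (v w : TangentSpace I x) :
    ricci I x v w = -∑ i, inner ℝ w (curvature I x (s i x) v (s i x)) := by
  have h (z : TangentSpace I x) : inner ℝ (curvature I x z v w) z
      = -hs.curvatureForm hx v w z z := by
    rw [inner_curvature_swap hs hx, curvatureForm_apply, real_inner_comm]
  simp only [ricci, h, Finset.sum_neg_distrib]
  rw [sum_bilin_orthonormalBasis _ (onb I x) (hs.basis hx)]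
  simp

end IsOrthonormalFrame

end FrameFormulas

section Adapted

variable {n : ℕ}
  {M : Type*} [TopologicalSpace M] [ChartedSpace (EuclideanSpace ℝ (Fin (n + 1))) M]
  [IsManifold (𝓡 (n + 1)) ∞ M] [RiemannianBundle (fun x : M => TangentSpace (𝓡 (n + 1)) x)]
  [IsContMDiffRiemannianBundle (𝓡 (n + 1)) ∞ (EuclideanSpace ℝ (Fin (n + 1)))
    (fun x : M => TangentSpace (𝓡 (n + 1)) x)]
  {N : Type*} [TopologicalSpace N] [ChartedSpace (EuclideanSpace ℝ (Fin n)) N]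
  [IsManifold (𝓡 n) ∞ N] [RiemannianBundle (fun y : N => TangentSpace (𝓡 n) y)]
  [IsContMDiffRiemannianBundle (𝓡 n) ∞ (EuclideanSpace ℝ (Fin n))
    (fun y : N => TangentSpace (𝓡 n) y)]
  {φ : M → N} {A : AdaptedFrame n φ} {x : M}

theorem AdaptedFrame.isOrthonormalFrame_e (A : AdaptedFrame n φ) :
    IsOrthonormalFrame (𝓡 (n + 1)) A.domain A.e where
  isOpen := A.isOpen_domain
  contMDiffOn := A.contMDiffOn_e
  orthonormal := A.orthonormal_e
  card_eq := by simp

theorem AdaptedFrame.isOrthonormalFrame_ε (A : AdaptedFrame n φ) :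
    IsOrthonormalFrame (𝓡 n) A.base A.ε where
  isOpen := A.isOpen_base
  contMDiffOn := A.contMDiffOn_ε
  orthonormal := A.orthonormal_ε
  card_eq := by simp

theorem AdaptedFrame.mfderiv_eq_sum (A : AdaptedFrame n φ) (hx : x ∈ A.domain)
    (v : TangentSpace (𝓡 (n + 1)) x) :
    mfderiv (𝓡 (n + 1)) (𝓡 n) φ x v
      = ∑ i : Fin n, inner ℝ (A.e i.castSucc x) v • A.ε i (φ x) := by
  conv_lhs => rw [← A.isOrthonormalFrame_e.sum_inner_smul hx v]
  rw [map_sum, Fin.sum_univ_castSucc]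
  simp only [map_smul, A.related x hx, A.vertical x hx, smul_zero, add_zero]

namespace IntegrabilityData

variable (D : IntegrabilityData A)

section Christoffel

variable (hx : x ∈ A.domain)

include hx

theorem inner_bracket_horizontal (i j k : Fin n) :
    inner ℝ (A.e k.castSucc x) (VectorField.mlieBracket (𝓡 (n + 1)) (A.e i.castSucc)
      (A.e j.castSucc) x) = D.f i j k x := by
  rw [D.bracket_horizontal x hx]
  simp [inner_sub_right, inner_sum, inner_smul_right, A.isOrthonormalFrame_e.inner_eq_ite hx,
    Fin.castSucc_ne_last, f]

theorem inner_bracket_vertical (i : Fin n) (a : Fin (n + 1)) :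
    inner ℝ (A.e a x) (VectorField.mlieBracket (𝓡 (n + 1)) (A.e i.castSucc)
      (A.e (Fin.last n)) x) = if a = Fin.last n then D.κ i x else 0 := by
  rw [D.bracket_vertical x hx]
  simp [inner_smul_right, A.isOrthonormalFrame_e.inner_eq_ite hx]

/-- The horizontal covariant derivatives `∇_{e_i} e_i = ∑_l P^l_{ii} e_l`. -/
theorem leviCivita_horizontal (i : Fin n) :
    leviCivita (𝓡 (n + 1)) (A.e i.castSucc) x (A.e i.castSucc x)
      = ∑ l : Fin n, D.P i i l x • A.e l.castSucc x := by
  refine A.isOrthonormalFrame_e.ext_of_inner hx fun a => ?_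
  rw [A.isOrthonormalFrame_e.inner_leviCivita hx]
  refine Fin.lastCases ?_ (fun l => ?_) a
  · rw [D.inner_bracket_vertical hx]
    simp [inner_sum, inner_smul_right, A.isOrthonormalFrame_e.inner_eq_ite hx,
      Fin.castSucc_ne_last, (Fin.castSucc_ne_last _).symm]
  · simp only [D.inner_bracket_horizontal hx]
    simp [inner_sum, inner_smul_right, A.isOrthonormalFrame_e.inner_eq_ite hx, P]
    ring

/-- The vertical covariant derivative `∇_{e_{n+1}} e_{n+1} = ∑_l κ_l e_l`. -/
theorem leviCivita_vertical :
    leviCivita (𝓡 (n + 1)) (A.e (Fin.last n)) x (A.e (Fin.last n) x)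
      = ∑ l : Fin n, D.κ l x • A.e l.castSucc x := by
  refine A.isOrthonormalFrame_e.ext_of_inner hx fun a => ?_
  rw [A.isOrthonormalFrame_e.inner_leviCivita hx]
  refine Fin.lastCases ?_ (fun l => ?_) a
  · simp [inner_sum, inner_smul_right, A.isOrthonormalFrame_e.inner_eq_ite hx,
      (Fin.castSucc_ne_last _).symm]
  · rw [VectorField.mlieBracket_swap_apply (V := A.e (Fin.last n)) (W := A.e l.castSucc)]
    simp [D.inner_bracket_vertical hx, inner_sum, inner_smul_right,
      A.isOrthonormalFrame_e.inner_eq_ite hx]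
    ring

/-- The covariant derivatives `∇_{ε_i} ε_j = ∑_k P^k_{ij} ε_k` on the base. -/
theorem leviCivita_base (i j : Fin n) :
    leviCivita (𝓡 n) (A.ε j) (φ x) (A.ε i (φ x)) = ∑ k, D.P i j k x • A.ε k (φ x) := by
  have hy := A.mapsTo hx
  refine A.isOrthonormalFrame_ε.ext_of_inner hy fun k => ?_
  rw [A.isOrthonormalFrame_ε.inner_leviCivita hy]
  simp only [D.bracket_ε _ hy]
  simp [inner_sum, inner_smul_right, A.isOrthonormalFrame_ε.inner_eq_ite hy, P, f]
  ring

end Christoffel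

/-- The connection forms `v ↦ ⟨ε_k, ∇_{dφ(v)} ε_j⟩` of the frame of the base, pulled back to `M`. -/
def connForm (j k : Fin n) (x : M) : TangentSpace (𝓡 (n + 1)) x →ₗ[ℝ] ℝ :=
  ∑ i : Fin n, D.P i j k x • innerₛₗ ℝ (A.e i.castSucc x)

theorem connForm_apply (j k : Fin n) (v : TangentSpace (𝓡 (n + 1)) x) :
    D.connForm j k x v = ∑ i : Fin n, D.P i j k x * inner ℝ (A.e i.castSucc x) v := by
  simp [connForm, LinearMap.sum_apply]

theorem connForm_horizontal (hx : x ∈ A.domain) (i j k : Fin n) :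
    D.connForm j k x (A.e i.castSucc x) = D.P i j k x := by
  simp [connForm_apply, A.isOrthonormalFrame_e.inner_eq_ite hx]

theorem connForm_vertical (hx : x ∈ A.domain) (j k : Fin n) :
    D.connForm j k x (A.e (Fin.last n) x) = 0 := by
  simp [connForm_apply, A.isOrthonormalFrame_e.inner_eq_ite hx, Fin.castSucc_ne_last]

theorem leviCivita_base_mfderiv (hx : x ∈ A.domain) (j : Fin n)
    (v : TangentSpace (𝓡 (n + 1)) x) :
    leviCivita (𝓡 n) (A.ε j) (φ x) (mfderiv (𝓡 (n + 1)) (𝓡 n) φ x v)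
      = ∑ k, D.connForm j k x v • A.ε k (φ x) := by
  have hd := A.isOrthonormalFrame_ε.mdifferentiableAt (A.mapsTo hx) j
  rw [A.mfderiv_eq_sum hx, leviCivita_sum_apply hd]
  simp only [leviCivita_smul_apply hd, D.leviCivita_base hx, connForm_apply, Finset.smul_sum,
    Finset.sum_smul, smul_smul]
  rw [Finset.sum_comm]
  simp only [mul_comm]

/-- The pull-back connection in an adapted frame. -/
theorem pullbackConn_eq (hφ : MDifferentiableAt (𝓡 (n + 1)) (𝓡 n) φ x) (hx : x ∈ A.domain)
    {W : Π x : M, TangentSpace (𝓡 n) (φ x)} {w : Fin n → M → ℝ} 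
    (hw : ∀ k, MDifferentiableAt (𝓡 (n + 1)) 𝓘(ℝ, ℝ) (w k) x)
    (hW : ∀ᶠ y in nhds x, W y = ∑ k, w k y • A.ε k (φ y)) (v : TangentSpace (𝓡 (n + 1)) x) :
    pullbackConn (𝓡 (n + 1)) (𝓡 n) φ W x v
      = ∑ k, (mvfderiv (𝓡 (n + 1)) (w k) x v + ∑ j, w j x * D.connForm j k x v)
        • A.ε k (φ x) := by
  rw [pullbackConn_eq_sum hφ A.isOrthonormalFrame_ε (A.mapsTo hx) hw hW]
  simp only [D.leviCivita_base_mfderiv hx, Finset.sum_add_distrib, add_smul, Finset.smul_sum,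
    Finset.sum_smul, smul_smul]
  rw [Finset.sum_comm (f := fun i j => (w i x * D.connForm i j x v) • A.ε j (φ x))]

end IntegrabilityData

end Adapted

section Bitension

variable {n : ℕ}
  {M : Type*} [TopologicalSpace M] [ChartedSpace (EuclideanSpace ℝ (Fin (n + 1))) M]
  [IsManifold (𝓡 (n + 1)) ∞ M] [RiemannianBundle (fun x : M => TangentSpace (𝓡 (n + 1)) x)]
  [IsContMDiffRiemannianBundle (𝓡 (n + 1)) ∞ (EuclideanSpace ℝ (Fin (n + 1)))
    (fun x : M => TangentSpace (𝓡 (n + 1)) x)]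
  {N : Type*} [TopologicalSpace N] [ChartedSpace (EuclideanSpace ℝ (Fin n)) N]
  [IsManifold (𝓡 n) ∞ N] [RiemannianBundle (fun y : N => TangentSpace (𝓡 n) y)]
  [IsContMDiffRiemannianBundle (𝓡 n) ∞ (EuclideanSpace ℝ (Fin n))
    (fun y : N => TangentSpace (𝓡 n) y)]
  {φ : M → N} {A : AdaptedFrame n φ} {x : M}

namespace IntegrabilityData

variable (D : IntegrabilityData A)

/-- The trace of the covariant derivative of a differential form in an adapted frame. -/
theorem sum_frame_covDeriv_form (hx : x ∈ A.domain)
    (G : Π y : M, TangentSpace (𝓡 (n + 1)) y →ₗ[ℝ] ℝ) :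
    ∑ a, (mvfderiv (𝓡 (n + 1)) (fun y => G y (A.e a y)) x (A.e a x)
        - G x (leviCivita (𝓡 (n + 1)) (A.e a) x (A.e a x)))
      = ∑ i : Fin n, (A.along i (fun y => G y (A.e i.castSucc y)) x
          - ∑ l : Fin n, D.P i i l x * G x (A.e l.castSucc x))
        + (mvfderiv (𝓡 (n + 1)) (fun y => G y (A.e (Fin.last n) y)) x (A.e (Fin.last n) x)
          - ∑ l : Fin n, D.κ l x * G x (A.e l.castSucc x)) := by
  rw [Fin.sum_univ_castSucc]
  simp only [D.leviCivita_horizontal hx, D.leviCivita_vertical hx, map_sum, map_smul, smul_eq_mul]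
  rfl

theorem laplacian_eq (hx : x ∈ A.domain) {f : M → ℝ}
    (hf : ContMDiffAt (𝓡 (n + 1)) 𝓘(ℝ, ℝ) ∞ f x) :
    laplacian (𝓡 (n + 1)) f x
      = ∑ i : Fin n, (A.along i (A.along i f) x - ∑ l : Fin n, D.P i i l x * A.along l f x)
        + (mvfderiv (𝓡 (n + 1)) (fun y => mvfderiv (𝓡 (n + 1)) f y (A.e (Fin.last n) y)) x
            (A.e (Fin.last n) x)
          - ∑ l : Fin n, D.κ l x * A.along l f x) := by
  rw [A.isOrthonormalFrame_e.laplacian_eq hx hf]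
  exact D.sum_frame_covDeriv_form hx (fun y => (mvfderiv (𝓡 (n + 1)) f y).toLinearMap)

/-- The trace of the covariant derivative of a one-form with values in `φ⁻¹ TN`, in an adapted
frame. -/
theorem inner_sum_pullbackConn (hφ : MDifferentiableAt (𝓡 (n + 1)) (𝓡 n) φ x)
    (hx : x ∈ A.domain)
    {Ω : Π y : M, TangentSpace (𝓡 (n + 1)) y → TangentSpace (𝓡 n) (φ y)}
    {g : Fin n → Π y : M, TangentSpace (𝓡 (n + 1)) y →ₗ[ℝ] ℝ}
    (hΩ : ∀ᶠ y in nhds x, ∀ v, Ω y v = ∑ k, g k y v • A.ε k (φ y))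
    (hg : ∀ k a, MDifferentiableAt (𝓡 (n + 1)) 𝓘(ℝ, ℝ) (fun y => g k y (A.e a y)) x) (k : Fin n) :
    inner ℝ (A.ε k (φ x)) (∑ a, (pullbackConn (𝓡 (n + 1)) (𝓡 n) φ
          (fun y => Ω y (ext (𝓡 (n + 1)) (onb (𝓡 (n + 1)) x a) y)) x (onb (𝓡 (n + 1)) x a)
        - Ω x (leviCivita (𝓡 (n + 1)) (ext (𝓡 (n + 1)) (onb (𝓡 (n + 1)) x a)) x
          (onb (𝓡 (n + 1)) x a))))
      = ∑ i : Fin n, (A.along i (fun y => g k y (A.e i.castSucc y)) x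
          - ∑ l : Fin n, D.P i i l x * g k x (A.e l.castSucc x))
        + (mvfderiv (𝓡 (n + 1)) (fun y => g k y (A.e (Fin.last n) y)) x (A.e (Fin.last n) x)
          - ∑ l : Fin n, D.κ l x * g k x (A.e l.castSucc x))
        + ∑ i : Fin n, ∑ j : Fin n, g j x (A.e i.castSucc x) * D.P i j k x := by
  let B : TangentSpace (𝓡 (n + 1)) x →ₗ[ℝ] TangentSpace (𝓡 (n + 1)) x →ₗ[ℝ] ℝ :=
    ∑ j, LinearMap.smulRight (g j x) (D.connForm j k x)
  have hB (v w : TangentSpace (𝓡 (n + 1)) x) : B v w = ∑ j, g j x v * D.connForm j k x w := by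
    simp [B, LinearMap.sum_apply]
  have hterm (v : TangentSpace (𝓡 (n + 1)) x) :
      inner ℝ (A.ε k (φ x)) (pullbackConn (𝓡 (n + 1)) (𝓡 n) φ
          (fun y => Ω y (ext (𝓡 (n + 1)) v y)) x v
        - Ω x (leviCivita (𝓡 (n + 1)) (ext (𝓡 (n + 1)) v) x v))
      = (mvfderiv (𝓡 (n + 1)) (fun y => g k y (ext (𝓡 (n + 1)) v y)) x v
        - g k x (leviCivita (𝓡 (n + 1)) (ext (𝓡 (n + 1)) v) x v)) + B v v := by
    rw [D.pullbackConn_eq hφ hx (w := fun k y => g k y (ext (𝓡 (n + 1)) v y))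
      (fun k => A.isOrthonormalFrame_e.mdifferentiableAt_form hx (hg k) (mdifferentiableAt_ext v))
      (hΩ.mono fun y hy => hy _), hΩ.self_of_nhds, inner_sub_right, hB]
    simp [inner_sum, inner_smul_right, A.isOrthonormalFrame_ε.inner_eq_ite (A.mapsTo hx)]
    ring
  rw [inner_sum]
  simp only [hterm, Finset.sum_add_distrib]
  rw [A.isOrthonormalFrame_e.sum_covDeriv_form hx (g k) (hg k), D.sum_frame_covDeriv_form hx,
    sum_bilin_orthonormalBasis B (onb (𝓡 (n + 1)) x) (A.isOrthonormalFrame_e.basis hx),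
    Fin.sum_univ_castSucc (f := fun a => B _ _)]
  simp [hB, D.connForm_horizontal hx, D.connForm_vertical hx]

/-- The tension field of a Riemannian submersion with one-dimensional fibres is
`-∑_k κ_k ε_k`. -/
theorem tension_eq (hφ : MDifferentiableAt (𝓡 (n + 1)) (𝓡 n) φ x) (hx : x ∈ A.domain) :
    tension (𝓡 (n + 1)) (𝓡 n) φ x = ∑ k, (-D.κ k x) • A.ε k (φ x) := by
  refine A.isOrthonormalFrame_ε.ext_of_inner (A.mapsTo hx) fun k => ?_
  have he := A.isOrthonormalFrame_e
  have hg (k : Fin n) (a : Fin (n + 1)) : MDifferentiableAt (𝓡 (n + 1)) 𝓘(ℝ, ℝ)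
      (fun y => innerₛₗ ℝ (A.e k.castSucc y) (A.e a y)) x :=
    mdifferentiableAt_inner (he.mdifferentiableAt hx _) (he.mdifferentiableAt hx _)
  have hΩ : ∀ᶠ y in nhds x, ∀ v, mfderiv (𝓡 (n + 1)) (𝓡 n) φ y v
      = ∑ k : Fin n, innerₛₗ ℝ (A.e k.castSucc y) v • A.ε k (φ y) := by
    filter_upwards [A.isOpen_domain.mem_nhds hx] with y hy v using A.mfderiv_eq_sum hy v
  refine (D.inner_sum_pullbackConn hφ hx
    (g := fun k y => innerₛₗ ℝ (A.e k.castSucc y)) hΩ hg k).trans ?_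
  simp only [innerₛₗ_apply_apply, AdaptedFrame.along, he.mvfderiv_inner_eq_zero hx, he.inner_eq_ite hx,
    inner_sum, inner_smul_right, A.isOrthonormalFrame_ε.inner_eq_ite (A.mapsTo hx)]
  simp

theorem contMDiffAt_P (hφ : ContMDiffAt (𝓡 (n + 1)) (𝓡 n) ∞ φ x) (hx : x ∈ A.domain)
    (i j k : Fin n) : ContMDiffAt (𝓡 (n + 1)) 𝓘(ℝ, ℝ) ∞ (D.P i j k) x := by
  have hF (i j k : Fin n) : ContMDiffAt (𝓡 (n + 1)) 𝓘(ℝ, ℝ) ∞ (D.f i j k) x :=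
    ((D.contMDiffOn_F i j k).contMDiffAt (A.isOpen_base.mem_nhds (A.mapsTo hx))).comp x hφ
  exact contMDiffAt_const.mul (((hF i k j).neg.sub (hF j k i)).add (hF i j k))

/-- The Laplacian on sections of `φ⁻¹ TN` in an adapted frame. -/
theorem inner_roughLaplacian (hφ : ContMDiff (𝓡 (n + 1)) (𝓡 n) ∞ φ) (hx : x ∈ A.domain)
    {W : Π x : M, TangentSpace (𝓡 n) (φ x)} {w : Fin n → M → ℝ}
    (hw : ∀ k, ContMDiffOn (𝓡 (n + 1)) 𝓘(ℝ, ℝ) ∞ (w k) A.domain)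
    (hW : ∀ y ∈ A.domain, W y = ∑ k, w k y • A.ε k (φ y)) (k : Fin n) :
    inner ℝ (A.ε k (φ x)) (-roughLaplacian (𝓡 (n + 1)) (𝓡 n) φ W x)
      = laplacian (𝓡 (n + 1)) (w k) x + ∑ i, ∑ j,
          (2 * A.along i (w j) x * D.P i j k x
            + w j x * (A.along i (D.P i j k) x + ∑ l, D.P i j l x * D.P i l k x
              - D.κ i x * D.P i j k x - ∑ l, D.P i i l x * D.P l j k x)) := by
  have he := A.isOrthonormalFrame_e
  have hmem : ∀ᶠ y in nhds x, y ∈ A.domain := A.isOpen_domain.mem_nhds hx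
  have hwy {y : M} (hy : y ∈ A.domain) (k : Fin n) :
      ContMDiffAt (𝓡 (n + 1)) 𝓘(ℝ, ℝ) ∞ (w k) y :=
    (hw k).contMDiffAt (A.isOpen_domain.mem_nhds hy)
  have hwd {y : M} (hy : y ∈ A.domain) (k : Fin n) :
      MDifferentiableAt (𝓡 (n + 1)) 𝓘(ℝ, ℝ) (w k) y := (hwy hy k).mdifferentiableAt (by simp)
  have hPd (i j k : Fin n) : MDifferentiableAt (𝓡 (n + 1)) 𝓘(ℝ, ℝ) (D.P i j k) x :=
    (D.contMDiffAt_P hφ.contMDiffAt hx i j k).mdifferentiableAt (by simp)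
  have hwe (k : Fin n) (a : Fin (n + 1)) : MDifferentiableAt (𝓡 (n + 1)) 𝓘(ℝ, ℝ)
      (fun y => mvfderiv (𝓡 (n + 1)) (w k) y (A.e a y)) x :=
    (contMDiffAt_mvfderiv_apply (hwy hx k) (he.contMDiffAt hx a)).mdifferentiableAt (by simp)
  have hφd (y : M) : MDifferentiableAt (𝓡 (n + 1)) (𝓡 n) φ y := hφ.mdifferentiableAt (by simp)
  let g (k : Fin n) (y : M) : TangentSpace (𝓡 (n + 1)) y →ₗ[ℝ] ℝ :=
    (mvfderiv (𝓡 (n + 1)) (w k) y).toLinearMap + ∑ j, w j y • D.connForm j k y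
  have hg_apply (k : Fin n) (y : M) (v : TangentSpace (𝓡 (n + 1)) y) :
      g k y v = mvfderiv (𝓡 (n + 1)) (w k) y v + ∑ j, w j y * D.connForm j k y v := by
    simp [g, LinearMap.sum_apply]
  have hΩ : ∀ᶠ y in nhds x, ∀ v, pullbackConn (𝓡 (n + 1)) (𝓡 n) φ W y v
      = ∑ k, g k y v • A.ε k (φ y) := by
    filter_upwards [hmem] with y hy v
    simp only [hg_apply]
    exact D.pullbackConn_eq (hφd y) hy (hwd hy)
      ((A.isOpen_domain.eventually_mem hy).mono fun z hz => hW z hz) v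
  have hgh (k i : Fin n) : (fun y => g k y (A.e i.castSucc y)) =ᶠ[nhds x]
      fun y => A.along i (w k) y + ∑ j, w j y * D.P i j k y := by
    filter_upwards [hmem] with y hy
    simp only [hg_apply, D.connForm_horizontal hy, AdaptedFrame.along]
  have hgv (k : Fin n) : (fun y => g k y (A.e (Fin.last n) y)) =ᶠ[nhds x]
      fun y => mvfderiv (𝓡 (n + 1)) (w k) y (A.e (Fin.last n) y) := by
    filter_upwards [hmem] with y hy
    simp [hg_apply, D.connForm_vertical hy]
  have hmul (i j k : Fin n) : MDifferentiableAt (𝓡 (n + 1)) 𝓘(ℝ, ℝ)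
      (fun y => w j y * D.P i j k y) x := (hwd hx j).mul (hPd i j k)
  have hsum (i k : Fin n) : MDifferentiableAt (𝓡 (n + 1)) 𝓘(ℝ, ℝ)
      (fun y => ∑ j, w j y * D.P i j k y) x :=
    mdifferentiableAt_sum Finset.univ fun j _ => hmul i j k
  have hg (k : Fin n) (a : Fin (n + 1)) :
      MDifferentiableAt (𝓡 (n + 1)) 𝓘(ℝ, ℝ) (fun y => g k y (A.e a y)) x := by
    refine Fin.lastCases ?_ (fun i => ?_) a
    · exact (hwe k _).congr_of_eventuallyEq (hgv k)
    · exact ((hwe k _).add (hsum i k)).congr_of_eventuallyEq (hgh k i)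
  have hderiv (i : Fin n) : A.along i (fun y => g k y (A.e i.castSucc y)) x
      = A.along i (A.along i (w k)) x
        + ∑ j, (w j x * A.along i (D.P i j k) x + D.P i j k x * A.along i (w j) x) := by
    simp only [AdaptedFrame.along]
    rw [mvfderiv_congr (hgh k i)]
    refine (congrArg (fun L => L (A.e i.castSucc x)) (mvfderiv_add (hwe k _) (hsum i k))).trans ?_
    rw [add_apply, mvfderiv_sum Finset.univ fun j _ => hmul i j k, sum_apply]
    refine congrArg₂ _ rfl (Finset.sum_congr rfl fun j _ => ?_)
    rw [mvfderiv_fun_mul (hwd hx j) (hPd i j k)]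
    rfl
  rw [roughLaplacian, neg_neg]
  refine (D.inner_sum_pullbackConn (hφd x) hx hΩ hg k).trans ?_
  rw [mvfderiv_congr (hgv k), D.laplacian_eq hx (hwy hx k)]
  have hgx (k i : Fin n) : g k x (A.e i.castSucc x)
      = A.along i (w k) x + ∑ j, w j x * D.P i j k x := (hgh k i).self_of_nhds
  simp only [hderiv, hgx]
  have e1 : ∑ i, ∑ j, (∑ l, w l x * D.P i l j x) * D.P i j k x
      = ∑ i, ∑ j, w j x * ∑ l, D.P i j l x * D.P i l k x := by
    refine Finset.sum_congr rfl fun i _ => ?_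
    simp only [Finset.sum_mul, Finset.mul_sum]
    rw [Finset.sum_comm]
    simp only [mul_assoc]
  have e2 : ∑ i, ∑ l, D.P i i l x * ∑ j, w j x * D.P l j k x
      = ∑ i, ∑ j, w j x * ∑ l, D.P i i l x * D.P l j k x := by
    refine Finset.sum_congr rfl fun i _ => ?_
    simp only [Finset.mul_sum]
    rw [Finset.sum_comm]
    simp only [mul_left_comm]
  have e3 : ∑ l, D.κ l x * ∑ j, w j x * D.P l j k x
      = ∑ i, ∑ j, w j x * (D.κ i x * D.P i j k x) := by
    simp only [Finset.mul_sum, mul_left_comm]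
  simp only [mul_add, mul_sub, add_mul, Finset.sum_add_distrib, Finset.sum_sub_distrib, e1, e2, e3]
  have e4 : ∑ i, ∑ j, 2 * A.along i (w j) x * D.P i j k x
      = ∑ i, ∑ j, D.P i j k x * A.along i (w j) x
        + ∑ i, ∑ j, A.along i (w j) x * D.P i j k x := by
    simp only [← Finset.sum_add_distrib]
    exact Finset.sum_congr rfl fun i _ => Finset.sum_congr rfl fun j _ => by ring
  rw [e4]
  ring

/-- The image under `dφ` of the mean curvature vector field of the fibres. -/
theorem mfderiv_fibreMeanCurvature (D : IntegrabilityData A)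
    (hφ : MDifferentiableAt (𝓡 (n + 1)) (𝓡 n) φ x)
    (hx : x ∈ A.domain) :
    mfderiv (𝓡 (n + 1)) (𝓡 n) φ x
        (fibreMeanCurvature (𝓡 (n + 1)) (𝓡 n) φ (A.e (Fin.last n)) x)
      = -tension (𝓡 (n + 1)) (𝓡 n) φ x := by
  set K := LinearMap.ker (mfderiv (𝓡 (n + 1)) (𝓡 n) φ x).toLinearMap
  have h (v : TangentSpace (𝓡 (n + 1)) x) : mfderiv (𝓡 (n + 1)) (𝓡 n) φ x
      ((horizontal (𝓡 (n + 1)) (𝓡 n) φ x).starProjection v)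
      = mfderiv (𝓡 (n + 1)) (𝓡 n) φ x v := by
    have h1 : v - Kᗮ.starProjection v ∈ Kᗮᗮ := Kᗮ.sub_starProjection_mem_orthogonal v
    rw [Submodule.orthogonal_orthogonal] at h1
    have h2 : mfderiv (𝓡 (n + 1)) (𝓡 n) φ x (v - Kᗮ.starProjection v) = 0 := h1
    rw [map_sub, sub_eq_zero] at h2
    exact h2.symm
  rw [fibreMeanCurvature, h, D.leviCivita_vertical hx, D.tension_eq hφ hx, map_sum]
  simp [A.related x hx]

/-- The components of the bitension field in an adapted frame. -/
theorem inner_bitension (hφ : ContMDiff (𝓡 (n + 1)) (𝓡 n) ∞ φ) (hx : x ∈ A.domain) (k : Fin n) :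
    inner ℝ (A.ε k (φ x)) (bitension (𝓡 (n + 1)) (𝓡 n) φ x)
      = -(laplacian (𝓡 (n + 1)) (D.κ k) x
          + ∑ i, ∑ j,
            (2 * A.along i (D.κ j) x * D.P i j k x
              + D.κ j x *
                (A.along i (D.P i j k) x
                  + ∑ l, D.P i j l x * D.P i l k x
                  - D.κ i x * D.P i j k x
                  - ∑ l, D.P i i l x * D.P l j k x))
          + ricci (𝓡 n) (φ x)
              (mfderiv (𝓡 (n + 1)) (𝓡 n) φ x
                (fibreMeanCurvature (𝓡 (n + 1)) (𝓡 n) φ (A.e (Fin.last n)) x))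
              (mfderiv (𝓡 (n + 1)) (𝓡 n) φ x (A.e k.castSucc x))) := by
  have hφd (y : M) : MDifferentiableAt (𝓡 (n + 1)) (𝓡 n) φ y := hφ.mdifferentiableAt (by simp)
  have hε := A.isOrthonormalFrame_ε
  have hy := A.mapsTo hx
  set τ := tension (𝓡 (n + 1)) (𝓡 n) φ x with hτ
  let dφ : TangentSpace (𝓡 (n + 1)) x →ₗ[ℝ] TangentSpace (𝓡 n) (φ x) :=
    (mfderiv (𝓡 (n + 1)) (𝓡 n) φ x).toLinearMap
  have hcurv : ∑ a, inner ℝ (A.ε k (φ x)) (curvature (𝓡 n) (φ x)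
        (mfderiv (𝓡 (n + 1)) (𝓡 n) φ x (onb (𝓡 (n + 1)) x a)) τ
        (mfderiv (𝓡 (n + 1)) (𝓡 n) φ x (onb (𝓡 (n + 1)) x a)))
      = ricci (𝓡 n) (φ x) (-τ) (A.ε k (φ x)) := by
    have h := sum_bilin_orthonormalBasis
      ((hε.curvatureForm hy τ (A.ε k (φ x))).compl₁₂ dφ dφ) (onb (𝓡 (n + 1)) x)
      (A.isOrthonormalFrame_e.basis hx)
    refine h.trans ?_
    have hd (i : Fin n) : dφ (A.e i.castSucc x) = A.ε i (φ x) := A.related x hx i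
    have hv : dφ (A.e (Fin.last n) x) = 0 := A.vertical x hx
    rw [Fin.sum_univ_castSucc, hε.ricci_eq hy]
    simp [hd, hv, hε.curvature_neg_middle hy]
  have hlap : laplacian (𝓡 (n + 1)) (fun y => -D.κ k y) x = -laplacian (𝓡 (n + 1)) (D.κ k) x := by
    simp only [laplacian, mvfderiv_fun_neg, neg_apply, ← Finset.sum_neg_distrib]
    exact Finset.sum_congr rfl fun a _ => by ring
  have halong (i j : Fin n) : A.along i (fun y => -D.κ j y) x = -A.along i (D.κ j) x := by
    simp only [AdaptedFrame.along, mvfderiv_fun_neg, neg_apply]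
  have hrough := D.inner_roughLaplacian hφ hx (w := fun k y => -D.κ k y)
    (fun k => (D.contMDiffOn_κ k).neg) (fun y hy => D.tension_eq (hφd y) hy) k
  rw [D.mfderiv_fibreMeanCurvature (hφd x) hx, A.related x hx, bitension, inner_sub_right, hrough,
    inner_sum, ← hτ, hcurv, hlap]
  simp only [halong, neg_add, ← Finset.sum_neg_distrib]
  rw [sub_eq_add_neg]
  refine congrArg₂ _ (congrArg₂ _ rfl ?_) rfl
  exact Finset.sum_congr rfl fun i _ => Finset.sum_congr rfl fun j _ => by ring

end IntegrabilityData

end Bitension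

end

end RiemSubm

theorem mainTheorem6 {n : ℕ}
    {M : Type*} [TopologicalSpace M] [ChartedSpace (EuclideanSpace ℝ (Fin (n + 1))) M]
    [IsManifold (𝓡 (n + 1)) ∞ M]
    [RiemannianBundle (fun x : M => TangentSpace (𝓡 (n + 1)) x)]
    [IsContMDiffRiemannianBundle (𝓡 (n + 1)) ∞ (EuclideanSpace ℝ (Fin (n + 1)))
      (fun x : M => TangentSpace (𝓡 (n + 1)) x)]
    {N : Type*} [TopologicalSpace N] [ChartedSpace (EuclideanSpace ℝ (Fin n)) N]
    [IsManifold (𝓡 n) ∞ N]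
    [RiemannianBundle (fun y : N => TangentSpace (𝓡 n) y)]
    [IsContMDiffRiemannianBundle (𝓡 n) ∞ (EuclideanSpace ℝ (Fin n))
      (fun y : N => TangentSpace (𝓡 n) y)]
    (φ : M → N) (hφ : RiemSubm.IsRiemannianSubmersion (𝓡 (n + 1)) (𝓡 n) φ)
    {ι : Type*} (A : ι → RiemSubm.AdaptedFrame n φ)
    (D : ∀ α, RiemSubm.IntegrabilityData (A α)) :
    RiemSubm.IsBiharmonicOn (𝓡 (n + 1)) (𝓡 n) φ (⋃ α, (A α).domain) ↔
      ∀ α, ∀ k : Fin n, ∀ x ∈ (A α).domain,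
        RiemSubm.laplacian (𝓡 (n + 1)) ((D α).κ k) x
          + ∑ i, ∑ j,
            (2 * (A α).along i ((D α).κ j) x * (D α).P i j k x
              + (D α).κ j x *
                ((A α).along i ((D α).P i j k) x
                  + ∑ l, (D α).P i j l x * (D α).P i l k x
                  - (D α).κ i x * (D α).P i j k x
                  - ∑ l, (D α).P i i l x * (D α).P l j k x))
          + RiemSubm.ricci (𝓡 n) (φ x)
              (mfderiv (𝓡 (n + 1)) (𝓡 n) φ x
                (RiemSubm.fibreMeanCurvature (𝓡 (n + 1)) (𝓡 n) φ ((A α).e (Fin.last n)) x))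
              (mfderiv (𝓡 (n + 1)) (𝓡 n) φ x ((A α).e k.castSucc x)) = 0 := by
  constructor
  · intro h α k x hx
    have hb := (D α).inner_bitension hφ.contMDiff hx k
    rw [h x (Set.mem_iUnion.2 ⟨α, hx⟩), inner_zero_right] at hb
    exact neg_eq_zero.mp hb.symm
  · intro h x hx
    obtain ⟨α, hα⟩ := Set.mem_iUnion.1 hx
    refine (A α).isOrthonormalFrame_ε.ext_of_inner ((A α).mapsTo hα) fun k => ?_
    rw [(D α).inner_bitension hφ.contMDiff hα k, h α k x hα, neg_zero, inner_zero_right]
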